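/- Work over $\mathbb{Q}$. A composition $\alpha=(\alpha_1,\dots,\alpha_k)$ is a finite, possibly empty, sequence of positive integers. Let $\mathrm{NSym}=\mathbb{Q}\langle \mathbf{e}_1,\mathbf{e}_2,\dots\rangle$ be the free associative algebra, with $\mathbf{e}_0=1$ and $\mathbf{e}_k=0$ for $k<0$; put $\mathbf{h}_n=\sum_{(\alpha_1,\dots,\alpha_m)\vDash n}(-1)^{n-m}\mathbf{e}_{\alpha_1}\cdots\mathbf{e}_{\alpha_m}$ (so $\mathbf h_0=1$) and $\mathbf{h}_\alpha=\mathbf{h}_{\alpha_1}\cdots\mathbf{h}_{\alpha_k}$. Let $\mathrm{QSym}\subset\mathbb{Q}[[x_1,x_2,\dots]]$ be the algebra of quasisymmetric functions of bounded degree, with monomial basis $M_\alpha$ and fundamental basis $F_\alpha$, and let $\langle\cdot,\cdot\rangle:\mathrm{NSym}\times\mathrm{QSym}\to\mathbb{Q}$ be the bilinear pairing with $\langle\mathbf{h}_\alpha,M_\beta\rangle=\delta_{\alpha\beta}$. For $F\in\mathrm{QSym}$ let $F^\perp:\mathrm{NSym}\to\mathrm{NSym}$ be the linear operator with $\langle F^\perp(g),b\rangle=\langle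 g,Fb\rangle$ for all $g\in\mathrm{NSym}$, $b\in\mathrm{QSym}$. For a composition $\alpha$, let $\mathcal{R}\mathfrak{S}^*_\alpha=\sum_U x^U\in\mathrm{QSym}$ be the row-strict dual immaculate function, where $U$ runs over the fillings with positive integers of the diagram of $\alpha$ (left-justified, with $\alpha_i$ cells in row $i$, row $1$ at the bottom) whose leftmost column weakly increases from bottom to top and whose rows strictly increase from left to right, and where $x^U$ is the product of $x_j$ over all entries $j$ of $U$. For $m\in\mathbb{Z}$ define the operator on $\mathrm{NSym}$ $$\mathbb{B}^{rs}_m=\sum_{i\ge 0}(-1)^i\,\mathbf{e}_{m+i}\,F^\perp_{(i)},\qquad F_{(0)}=F_\emptyset=1,$$ where $\mathbf{e}_{m+i}$ acts by left multiplication (the sum is finite on each element), and for $\alpha=(\alpha_1,\dots,\alpha_k)$ put $\mathbb{B}^{rs}_\alpha=\mathbb{B}^{rs}_{\alpha_1}\cdots\mathbb{B}^{rs}_{\alpha_k}$ (the identity if $\alpha=\emptyset$). **Theorem.** The functions $\mathcal{R}\mathfrak{S}^*_\alpha$, $\alpha$ running over all compositions, form a basis of $\mathrm{QSym}$ that has a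 dual basis in $\mathrm{NSym}$: there is a basis $(\mathcal{R}\mathfrak{S}_\alpha)_\alpha$ of $\mathrm{NSym}$, the row-strict immaculate functions, with $\langle\mathcal{R}\mathfrak{S}_\alpha,\mathcal{R}\mathfrak{S}^*_\beta\rangle=\delta_{\alpha\beta}$ for all $\alpha,\beta$. Any family $(\mathcal{R}\mathfrak{S}_\alpha)_\alpha$ in $\mathrm{NSym}$ satisfying these relations is given by $$\mathcal{R}\mathfrak{S}_\alpha=\mathbb{B}^{rs}_\alpha(1)\qquad\text{for every composition }\alpha.$$ -/

import Mathlib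

namespace RowStrictImm

/-- The algebra of noncommutative symmetric functions over `ℚ`: the free associative algebra on
indeterminates indexed by the positive integers (the elementary generators). -/
abbrev NSym : Type := FreeAlgebra ℚ ℕ+

/-- The elementary generator of degree `k`, with `e 0 = 1` and `e k = 0` for `k < 0`. -/
noncomputable def e (k : ℤ) : NSym :=
  if hk : 0 < k then FreeAlgebra.ι ℚ ⟨k.toNat, by omega⟩ else if k = 0 then 1 else 0

/-- The complete homogeneous noncommutative symmetric function of degree `n`: the signed sum of the
elementary monomials over all compositions of `n` (so that `h 0 = 1`). -/
noncomputable def h (n : ℕ) : NSym :=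
  ∑ c : Composition n, (-1 : ℚ) ^ (n - c.length) • (c.blocks.map fun k : ℕ => e k).prod

theorem e_zero : e 0 = 1 := by simp [e]

theorem e_pnat (n : ℕ+) : e (n : ℕ) = FreeAlgebra.ι ℚ n := by
  have hn : (0 : ℤ) < ((n : ℕ) : ℤ) := by exact_mod_cast n.pos
  rw [e, dif_pos hn]
  rfl

theorem h_zero : h 0 = 1 := by
  have hb : ∀ c : Composition 0, c.blocks = [] := fun c => c.blocks_eq_nil.2 rfl
  have hc : Fintype.card (Composition 0) = 1 := by simp [composition_card]
  simp [h, Composition.length, hb, hc]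

theorem star_e (k : ℕ) : star (e k) = e k := by
  rcases Nat.eq_zero_or_pos k with rfl | hk
  · simp [e]
  · have := e_pnat ⟨k, hk⟩
    simp only [PNat.mk_coe] at this
    rw [this]
    exact FreeAlgebra.star_ι (R := ℚ) _

theorem star_prod (l : List ℕ) :
    star (l.map fun k : ℕ => e k).prod = (l.reverse.map fun k : ℕ => e k).prod := by
  induction l with
  | nil => simp
  | cons a l ih => simp [ih, star_e]

theorem star_smulQ (q : ℚ) (x : NSym) : star (q • x) = q • star x := by
  rw [Algebra.smul_def, star_mul, FreeAlgebra.star_algebraMap, Algebra.smul_def,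
    Algebra.commutes]

theorem star_h (n : ℕ) : star (h n) = h n := by
  unfold h
  rw [star_sum]
  simp only [star_smulQ, star_prod]
  refine Fintype.sum_bijective _ Composition.reverse_bijective _ _ ?_
  intro c
  simp [Composition.length]

theorem h_succ (n : ℕ) :
    h (n + 1) = ∑ k : Fin (n + 1), (-1 : ℚ) ^ (k : ℕ) • (e ((k : ℕ) + 1 : ℕ) * h (n - k)) := by
  unfold h
  simp only [Finset.mul_sum, Finset.smul_sum]
  rw [Finset.sum_sigma']
  symm
  let φ : (Σ k : Fin (n + 1), Composition (n - k)) → Composition (n + 1) := fun x =>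
    ⟨(x.1 + 1) :: x.2.blocks, by
      intro i hi
      rcases List.mem_cons.1 hi with rfl | hi
      · omega
      · exact x.2.blocks_pos hi, by
      have := x.1.2
      rw [List.sum_cons, x.2.blocks_sum]; omega⟩
  refine Fintype.sum_bijective φ ⟨?_, ?_⟩ _ _ ?_
  · rintro ⟨k, c⟩ ⟨k', c'⟩ hh
    have h1 := congrArg Composition.blocks hh
    simp only [φ, List.cons.injEq, add_left_inj] at h1
    obtain ⟨h1, h2⟩ := h1
    obtain rfl : k = k' := Fin.ext h1
    obtain rfl : c = c' := Composition.ext h2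
    rfl
  · intro c
    rcases c with ⟨l, hl, hs⟩
    cases l with
    | nil => simp at hs
    | cons a l =>
      have ha : 0 < a := hl (by simp)
      simp only [List.sum_cons] at hs
      refine ⟨⟨⟨a - 1, by omega⟩, ⟨l, fun hi => hl (by simp [hi]), ?_⟩⟩, ?_⟩
      · simp; omega
      · apply Composition.ext
        simp [φ]; omega
  · rintro ⟨k, c⟩
    have hc := c.length_le
    have hk := k.2
    simp only [φ, Composition.length, List.length_cons, List.map_cons, List.prod_cons] at hc ⊢
    rw [mul_smul_comm, smul_smul, ← pow_add]
    congr 2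
    omega

theorem h_succ' (n : ℕ) :
    h (n + 1) = ∑ k : Fin (n + 1), (-1 : ℚ) ^ (k : ℕ) • (h (n - k) * e ((k : ℕ) + 1 : ℕ)) := by
  conv_lhs => rw [← star_h, h_succ, star_sum]
  simp only [star_smulQ, star_mul, star_h, star_e]

/-- The algebra endomorphism with `e n ↦ h n`; it is an involution, so the `hProd α` form a basis. -/
noncomputable def swap : NSym →ₐ[ℚ] NSym := FreeAlgebra.lift ℚ fun n : ℕ+ => h n

theorem swap_e (n : ℕ) : swap (e n) = h n := by
  rcases Nat.eq_zero_or_pos n with rfl | hn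
  · simp [e, h_zero]
  · have := e_pnat ⟨n, hn⟩
    simp only [PNat.mk_coe] at this
    rw [this]
    exact FreeAlgebra.lift_ι_apply _ _

theorem swap_h (n : ℕ) : swap (h n) = e n := by
  induction n using Nat.strong_induction_on with
  | _ n ih =>
    cases n with
    | zero => simp [e, h_zero]
    | succ n =>
      have h1 := h_succ' n
      rw [h_succ, map_sum]
      simp only [map_smul, map_mul, swap_e]
      have h2 : ∀ k : Fin (n + 1), (-1 : ℚ) ^ (k : ℕ) • (h (k + 1) * swap (h (n - k)))
          = (-1 : ℚ) ^ (k : ℕ) • (h (k + 1) * e (n - k : ℕ)) := fun k => by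
        rw [ih (n - k) (by omega)]
      rw [Finset.sum_congr rfl fun k _ => h2 k]
      rw [Fin.sum_univ_eq_sum_range (fun k => (-1 : ℚ) ^ k • (h (n - k) * e (k + 1 : ℕ)))] at h1
      rw [Fin.sum_univ_eq_sum_range (fun k => (-1 : ℚ) ^ k • (h (k + 1) * e (n - k : ℕ)))]
      rw [← Finset.sum_range_reflect]
      have h3 : ∑ k ∈ Finset.range (n + 1 + 1), (-1 : ℚ) ^ k • (h (n + 1 - k) * e (k : ℕ)) = 0 := by
        rw [Finset.sum_range_succ']
        simp only [Nat.add_sub_add_right, pow_succ, mul_neg, mul_one, neg_smul,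
          Finset.sum_neg_distrib, ← h1]
        simp [e]
      rw [Finset.sum_range_succ, add_eq_zero_iff_eq_neg] at h3
      have h4 : ∀ j ∈ Finset.range (n + 1),
          (-1 : ℚ) ^ (n + 1 - 1 - j) • (h (n + 1 - 1 - j + 1) * e (n - (n + 1 - 1 - j) : ℕ))
          = (-1 : ℚ) ^ n • ((-1 : ℚ) ^ j • (h (n + 1 - j) * e (j : ℕ))) := by
        intro j hj
        have hj' : j ≤ n := by simpa [Nat.lt_succ_iff] using hj
        rw [smul_smul, ← pow_add, show n + 1 - 1 - j + 1 = n + 1 - j by omega,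
          show n - (n + 1 - 1 - j) = j by omega,
          show n + j = (n + 1 - 1 - j) + 2 * j by omega, pow_add _ _ (2 * j), pow_mul]
        simp
      rw [Finset.sum_congr rfl h4, ← Finset.smul_sum, h3, smul_neg, smul_smul, ← pow_add,
        show n + (n + 1) = 2 * n + 1 by ring, pow_succ, pow_mul]
      simp [h_zero]

theorem swap_swap : swap.comp swap = AlgHom.id ℚ NSym := by
  apply FreeAlgebra.hom_ext
  funext n
  simp only [Function.comp_apply, AlgHom.comp_apply, AlgHom.id_apply]
  rw [← e_pnat, swap_e, swap_h]

/-- The product `h α₁ * h α₂ * ⋯`. Compositions (of arbitrary nonnegative integers) are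
represented as lists of positive integers. -/
noncomputable def hProd (α : List ℕ+) : NSym := (α.map fun k : ℕ+ => h k).prod

theorem basisFreeMonoid_apply (x : FreeMonoid ℕ+) :
    FreeAlgebra.basisFreeMonoid ℚ ℕ+ x = FreeMonoid.lift (FreeAlgebra.ι ℚ) x := by
  have h0 : FreeAlgebra.basisFreeMonoid ℚ ℕ+ x =
      MonoidAlgebra.lift ℚ (FreeAlgebra ℚ ℕ+) (FreeMonoid ℕ+)
        (FreeMonoid.lift (FreeAlgebra.ι ℚ)) (MonoidAlgebra.single x 1) := by
    rw [FreeAlgebra.basisFreeMonoid, Module.Basis.map_apply, Finsupp.coe_basisSingleOne]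
    rfl
  rw [h0, MonoidAlgebra.lift_single, one_smul]

/-- The basis of complete homogeneous functions of `NSym`, see `hBasis_apply`. -/
noncomputable def hBasis : Module.Basis (List ℕ+) ℚ NSym :=
  ((FreeAlgebra.basisFreeMonoid ℚ ℕ+).reindex FreeMonoid.toList).map
    (AlgEquiv.ofAlgHom swap swap swap_swap swap_swap).toLinearEquiv

theorem hBasis_apply (α : List ℕ+) : hBasis α = hProd α := by
  have h2 : hBasis α = swap (α.map (FreeAlgebra.ι ℚ)).prod := by
    rw [hBasis, Module.Basis.map_apply, Module.Basis.reindex_apply, basisFreeMonoid_apply,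
      FreeMonoid.lift_apply]
    rfl
  rw [h2, map_list_prod, List.map_map, hProd]
  congr 1
  refine List.map_congr_left fun n _ => ?_
  rw [Function.comp_apply, ← e_pnat, swap_e]

/-- The exponent of the monomial `x_{i 0} ^ (a 0) * ⋯ * x_{i (k-1)} ^ (a (k-1))`. -/
noncomputable def expo {k : ℕ} (i a : Fin k → ℕ) : ℕ →₀ ℕ := ∑ j, Finsupp.single (i j) (a j)

theorem expo_eq {k : ℕ} (i : Fin k → ℕ) (hi : Function.Injective i) (a : Fin k → ℕ) :
    expo i a = Finsupp.embDomain ⟨i, hi⟩ (Finsupp.equivFunOnFinite.symm a) := by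
  ext m
  by_cases hm : m ∈ Set.range i
  · obtain ⟨j, rfl⟩ := hm
    have : (Finsupp.embDomain ⟨i, hi⟩ (Finsupp.equivFunOnFinite.symm a)) (i j) = a j := by
      exact Finsupp.embDomain_apply_self ⟨i, hi⟩ _ j
    rw [this]
    simp [expo, Finsupp.finsetSum_apply, Finsupp.single_apply, hi.eq_iff]
  · rw [Finsupp.embDomain_of_notMem_range _ _ _ hm]
    simp only [expo, Finsupp.finsetSum_apply, Finsupp.single_apply]
    exact Finset.sum_eq_zero fun j _ => if_neg fun hj => hm ⟨j, hj⟩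

/-- The coefficient of `x_{i 0} ^ (a 0) * ⋯ * x_{i (k-1)} ^ (a (k-1))`, `i` strictly increasing, does
not depend on `i`. The variables are indexed by `0, 1, 2, …` instead of `1, 2, 3, …`. Zero
exponents are allowed, which does not change the notion. -/
def IsQuasisymmetric (f : MvPowerSeries ℕ ℚ) : Prop :=
  ∀ (k : ℕ) (a i : Fin k → ℕ), StrictMono i →
    MvPowerSeries.coeff (expo i a) f = MvPowerSeries.coeff (expo (fun j => (j : ℕ)) a) f

/-- The degrees of the monomials occurring in `f` are bounded. -/
def HasBoundedDegree (f : MvPowerSeries ℕ ℚ) : Prop :=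
  ∃ N : ℕ, ∀ d : ℕ →₀ ℕ, MvPowerSeries.coeff d f ≠ 0 → d.degree ≤ N

theorem coeff_expo_mul {k : ℕ} (i : Fin k → ℕ) (hi : Function.Injective i) (a : Fin k → ℕ)
    (f g : MvPowerSeries ℕ ℚ) : MvPowerSeries.coeff (expo i a) (f * g) =
      ∑ p ∈ Finset.HasAntidiagonal.antidiagonal (Finsupp.equivFunOnFinite.symm a),
        MvPowerSeries.coeff (expo i p.1) f * MvPowerSeries.coeff (expo i p.2) g := by
  classical
  rw [MvPowerSeries.coeff_mul, expo_eq i hi, ← Finsupp.image_prodMap_embDomain_antidiagonal,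
    Finset.sum_image]
  · refine Finset.sum_congr rfl fun p _ => ?_
    rw [expo_eq i hi, expo_eq i hi]
    simp
  · intro p _ q _ hpq
    exact (Function.Injective.prodMap (Finsupp.embDomain_injective _)
      (Finsupp.embDomain_injective _)) hpq

theorem IsQuasisymmetric.mul {f g : MvPowerSeries ℕ ℚ} (hf : IsQuasisymmetric f)
    (hg : IsQuasisymmetric g) : IsQuasisymmetric (f * g) := by
  intro k a i hi
  rw [coeff_expo_mul i hi.injective, coeff_expo_mul _ Fin.val_injective]
  exact Finset.sum_congr rfl fun p _ => by rw [hf k _ i hi, hg k _ i hi]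

theorem HasBoundedDegree.mul {f g : MvPowerSeries ℕ ℚ} (hf : HasBoundedDegree f)
    (hg : HasBoundedDegree g) : HasBoundedDegree (f * g) := by
  classical
  obtain ⟨N, hN⟩ := hf
  obtain ⟨N', hN'⟩ := hg
  refine ⟨N + N', fun d hd => ?_⟩
  rw [MvPowerSeries.coeff_mul] at hd
  obtain ⟨p, hp, hne⟩ := Finset.exists_ne_zero_of_sum_ne_zero hd
  rw [← Finset.HasAntidiagonal.mem_antidiagonal.1 hp, map_add]
  exact add_le_add (hN _ (left_ne_zero_of_mul hne)) (hN' _ (right_ne_zero_of_mul hne))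

theorem expo_eq_zero_iff {k : ℕ} (i a : Fin k → ℕ) : expo i a = 0 ↔ a = 0 := by
  simp [expo, funext_iff]

/-- The algebra of quasisymmetric functions over `ℚ`. -/
noncomputable def QSym : Subalgebra ℚ (MvPowerSeries ℕ ℚ) where
  carrier := {f | HasBoundedDegree f ∧ IsQuasisymmetric f}
  mul_mem' hf hg := ⟨hf.1.mul hg.1, hf.2.mul hg.2⟩
  add_mem' := by
    rintro f g ⟨⟨N, hN⟩, hf⟩ ⟨⟨N', hN'⟩, hg⟩
    refine ⟨⟨max N N', fun d hd => ?_⟩, fun k a i hi => ?_⟩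
    · by_contra hlt
      rw [not_le, max_lt_iff] at hlt
      apply hd
      rw [map_add, not_not.1 (mt (hN d) (not_le.2 hlt.1)),
        not_not.1 (mt (hN' d) (not_le.2 hlt.2)), add_zero]
    · rw [map_add, map_add, hf k a i hi, hg k a i hi]
  algebraMap_mem' r := by
    classical
    refine ⟨⟨0, fun d hd => ?_⟩, fun k a i hi => ?_⟩
    · rw [MvPowerSeries.algebraMap_apply, MvPowerSeries.coeff_C] at hd
      have : d = 0 := by
        by_contra hne
        exact hd (if_neg hne)
      simp [this]
    · simp only [MvPowerSeries.algebraMap_apply, MvPowerSeries.coeff_C, expo_eq_zero_iff]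

section GeneratingFunction

variable {C : Type} [Fintype C]

/-- The generating function `∑ T, ∏ c, x_{T c} ^ (w c)` over all fillings `T : C → ℕ` satisfying `P`.
The coefficients are finite if all weights are positive, see `finite_content`. -/
noncomputable def genFun (w : C → ℕ) (P : (C → ℕ) → Prop) : MvPowerSeries ℕ ℚ :=
  fun d => (Nat.card {T : C → ℕ // P T ∧ ∑ c, Finsupp.single (T c) (w c) = d} : ℚ)

theorem coeff_genFun (w : C → ℕ) (P : (C → ℕ) → Prop) (d : ℕ →₀ ℕ) :
    MvPowerSeries.coeff d (genFun w P) =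
      (Nat.card {T : C → ℕ // P T ∧ ∑ c, Finsupp.single (T c) (w c) = d} : ℚ) := rfl

theorem mem_support_content {w : C → ℕ} (hw : ∀ c, 0 < w c) (T : C → ℕ) (c : C) :
    T c ∈ (∑ c, Finsupp.single (T c) (w c)).support := by
  rw [Finsupp.mem_support_iff, Finsupp.finsetSum_apply]
  have := Finset.single_le_sum (f := fun c' => Finsupp.single (T c') (w c') (T c))
    (fun _ _ => Nat.zero_le _) (Finset.mem_univ c)
  simp only [Finsupp.single_eq_same] at this
  have := hw c
  omega

theorem finite_content {w : C → ℕ} (hw : ∀ c, 0 < w c) (P : (C → ℕ) → Prop) (d : ℕ →₀ ℕ) :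
    Finite {T : C → ℕ // P T ∧ ∑ c, Finsupp.single (T c) (w c) = d} := by
  refine Finite.of_injective
    (fun T c => (⟨T.1 c, (congrArg (T.1 c ∈ Finsupp.support ·) T.2.2).mp (mem_support_content hw T.1 c)⟩ : d.support)) ?_
  intro T T' hT
  exact Subtype.ext (funext fun c => congrArg Subtype.val (congrFun hT c))

theorem genFun_mem {w : C → ℕ} (hw : ∀ c, 0 < w c) {P : (C → ℕ) → Prop}
    (hP : ∀ T T' : C → ℕ, (∀ b c, T b ≤ T c ↔ T' b ≤ T' c) → P T → P T') :
    genFun w P ∈ QSym := by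
  refine ⟨⟨∑ c, w c, fun d hd => ?_⟩, fun k a i hi => ?_⟩
  · rw [coeff_genFun, Nat.cast_ne_zero] at hd
    obtain ⟨T, -, rfl⟩ := (Nat.card_ne_zero.1 hd).1
    simp
  · have key : ∀ i : Fin k → ℕ, StrictMono i →
        MvPowerSeries.coeff (expo i a) (genFun w P) =
        (Nat.card {S : C → Fin k // P (fun c => (S c : ℕ)) ∧
          ∑ c, Finsupp.single (S c) (w c) = Finsupp.equivFunOnFinite.symm a} : ℚ) := by
      intro i hi
      rw [coeff_genFun]
      congr 1
      symm
      have hc : ∀ S : C → Fin k, ∑ c, Finsupp.single (i (S c)) (w c) =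
          Finsupp.embDomain ⟨i, hi.injective⟩ (∑ c, Finsupp.single (S c) (w c)) := by
        intro S
        have := map_sum (Finsupp.embDomain.addMonoidHom (M := ℕ) ⟨i, hi.injective⟩)
          (fun c => Finsupp.single (S c) (w c)) Finset.univ
        rw [Finsupp.embDomain.addMonoidHom_apply] at this
        rw [this]
        exact Finset.sum_congr rfl fun c _ =>
          (Finsupp.embDomain_single ⟨i, hi.injective⟩ (S c) (w c)).symm
      refine Nat.card_congr (Equiv.ofBijective (fun S => ⟨fun c => i (S.1 c), ?_, ?_⟩) ⟨?_, ?_⟩)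
      · exact hP _ _ (fun b c => by rw [hi.le_iff_le, Fin.le_def]) S.2.1
      · rw [hc, S.2.2, expo_eq i hi.injective]
      · intro S S' h
        exact Subtype.ext (funext fun c => hi.injective (congrFun (congrArg Subtype.val h) c))
      · rintro ⟨T, hT, hd⟩
        have hr : ∀ c, ∃ j, i j = T c := by
          intro c
          by_contra hne
          have h1 := mem_support_content hw T c
          rw [hd, expo_eq i hi.injective, Finsupp.mem_support_iff] at h1
          exact h1 (Finsupp.embDomain_of_notMem_range _ _ _ hne)
        choose S hS using hr
        obtain rfl : (fun c => i (S c)) = T := funext hS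
        refine ⟨⟨S, hP _ _ (fun b c => by rw [hi.le_iff_le, Fin.le_def]) hT, ?_⟩, rfl⟩
        rw [hc, expo_eq i hi.injective] at hd
        exact Finsupp.embDomain_injective _ hd
    rw [key i hi, key _ Fin.val_strictMono]

end GeneratingFunction

/-- The sum `|α|` of the parts of a composition. -/
def size (α : List ℕ+) : ℕ := (α.map fun k : ℕ+ => (k : ℕ)).sum

theorem size_eq (α : List ℕ+) : ∑ j : Fin α.length, (α.get j : ℕ) = size α := by
  rw [size, ← List.sum_ofFn]
  congr 1
  exact List.ext_get (by simp) fun n h1 h2 => by simp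

/-- The monomial quasisymmetric function: the sum of `x_{i 0} ^ α₁ * x_{i 1} ^ α₂ * ⋯` over all
strictly increasing index sequences. -/
noncomputable def M (α : List ℕ+) : QSym :=
  ⟨genFun (fun j : Fin α.length => (α.get j : ℕ)) (fun i => StrictMono i),
    genFun_mem (fun j => (α.get j).pos) fun T T' hT h b c hbc => by
      have := h hbc
      rw [← not_le, hT, not_le] at this
      exact this⟩

/-- The set `{α₁, α₁ + α₂, …, α₁ + ⋯ + α_{k-1}}` of proper partial sums of `α`. -/
def compSet (α : List ℕ+) : Set ℕ :=
  {s | ∃ r : ℕ, 0 < r ∧ r < α.length ∧ s = size (α.take r)}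

/-- The fundamental quasisymmetric function: the sum of `x_{i 1} * ⋯ * x_{i n}` over all
`i 1 ≤ ⋯ ≤ i n` such that `i j = i (j + 1)` only if `j ∉ compSet α`. The positions are numbered
from `0` here, so that the `j`-th and `(j + 1)`-st position are `p = j - 1` and `q = j`. -/
noncomputable def F (α : List ℕ+) : QSym :=
  ⟨genFun (fun _ : Fin (size α) => 1) (fun i => Monotone i ∧
      ∀ p q : Fin (size α), (q : ℕ) = p + 1 → i p = i q → (q : ℕ) ∉ compSet α),
    genFun_mem (fun _ => one_pos) fun T T' hT h => by
      refine ⟨fun b c hbc => (hT b c).1 (h.1 hbc), fun p q hpq he => h.2 p q hpq ?_⟩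
      exact le_antisymm ((hT _ _).2 he.le) ((hT _ _).2 he.ge)⟩

/-- The cells of the diagram of `α`; rows are numbered from the bottom. -/
abbrev Cell (α : List ℕ+) : Type := Σ r : Fin α.length, Fin (α.get r : ℕ)

/-- The leftmost cell of a row. -/
def firstCell (α : List ℕ+) (r : Fin α.length) : Cell α := ⟨r, ⟨0, (α.get r).pos⟩⟩

/-- Row-strict immaculate tableaux of shape `α`: the leftmost column weakly increases from bottom to
top and the rows strictly increase from left to right. -/
structure IsRowStrictTableau (α : List ℕ+) (T : Cell α → ℕ) : Prop where
  col_le : ∀ r s : Fin α.length, r ≤ s → T (firstCell α r) ≤ T (firstCell α s)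
  row_lt : ∀ (r : Fin α.length) (b c : Fin (α.get r : ℕ)), b < c → T ⟨r, b⟩ < T ⟨r, c⟩

/-- The row-strict dual immaculate function: the generating function of row-strict immaculate
tableaux of shape `α`. -/
noncomputable def rowStrictDual (α : List ℕ+) : QSym :=
  ⟨genFun (fun _ : Cell α => 1) (IsRowStrictTableau α),
    genFun_mem (fun _ => one_pos) fun T T' hT h =>
      ⟨fun r s hrs => (hT _ _).1 (h.col_le r s hrs), fun r b c hbc => by
        have := h.row_lt r b c hbc
        rw [← not_le, hT, not_le] at this
        exact this⟩⟩

/-- The exponent of `x_0 ^ α₁ * x_1 ^ α₂ * ⋯`. -/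
noncomputable def partExpo (α : List ℕ+) : ℕ →₀ ℕ :=
  expo (fun j : Fin α.length => (j : ℕ)) fun j => (α.get j : ℕ)

/-- The coefficient of `M α` in a quasisymmetric function, that is, of `x_0 ^ α₁ * x_1 ^ α₂ * ⋯`. -/
noncomputable def partCoeff (α : List ℕ+) : QSym →ₗ[ℚ] ℚ :=
  (MvPowerSeries.coeff (partExpo α)).comp QSym.val.toLinearMap

theorem partCoeff_apply (α : List ℕ+) (f : QSym) :
    partCoeff α f = MvPowerSeries.coeff (partExpo α) (f : MvPowerSeries ℕ ℚ) := rfl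

/-- The duality pairing of `NSym` and `QSym`, for which the bases `hProd` and `M` are dual, see
`pairing_h_M`. -/
noncomputable def pairing : NSym →ₗ[ℚ] QSym →ₗ[ℚ] ℚ := hBasis.constr ℚ partCoeff

theorem pairing_h (α : List ℕ+) (f : QSym) : pairing (hProd α) f = partCoeff α f := by
  rw [← hBasis_apply, pairing, Module.Basis.constr_basis]

theorem degree_expo {k : ℕ} (i a : Fin k → ℕ) : (expo i a).degree = ∑ j, a j := by
  simp [expo]

theorem degree_partExpo (α : List ℕ+) : (partExpo α).degree = size α := by
  rw [partExpo, degree_expo, size_eq]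

theorem support_expo {k : ℕ} (i a : Fin k → ℕ) (hi : Function.Injective i) (ha : ∀ j, 0 < a j) :
    (((expo i a).support : Finset ℕ) : Set ℕ) = Set.range i := by
  rw [expo_eq i hi, Finsupp.support_embDomain, Finset.coe_map]
  have : (Finsupp.equivFunOnFinite.symm a).support = Finset.univ := by
    ext j; simp [(ha j).ne']
  rw [this]
  simp

theorem expo_apply {k : ℕ} (i a : Fin k → ℕ) (hi : Function.Injective i) (j : Fin k) :
    expo i a (i j) = a j := by
  simp [expo, Finsupp.finsetSum_apply, Finsupp.single_apply, hi.eq_iff]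

theorem expo_inj {α β : List ℕ+} {i : Fin β.length → ℕ} (hi : StrictMono i)
    (h : expo i (fun j => (β.get j : ℕ)) = partExpo α) : i = (fun j : Fin β.length => (j : ℕ)) ∧ β = α := by
  have hs := congrArg (fun d : ℕ →₀ ℕ => ((d.support : Finset ℕ) : Set ℕ)) h
  simp only [partExpo] at hs
  rw [support_expo i _ hi.injective fun j => (β.get j).pos,
    support_expo _ _ Fin.val_injective fun j => (α.get j).pos] at hs
  have hl : β.length = α.length := by
    have := congrArg Set.ncard hs
    rw [← Set.image_univ, ← Set.image_univ, Set.ncard_image_of_injective _ hi.injective,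
      Set.ncard_image_of_injective _ Fin.val_injective] at this
    simpa [Set.ncard_univ] using this
  have hi' : i = fun j : Fin β.length => (j : ℕ) := by
    apply (StrictMono.range_inj hi Fin.val_strictMono).1
    rw [hs, Fin.range_val, Fin.range_val, hl]
  refine ⟨hi', List.ext_get hl fun n h1 h2 => ?_⟩
  subst hi'
  have := DFunLike.congr_fun h n
  have e1 := expo_apply (fun j : Fin β.length => (j : ℕ)) (fun j => (β.get j : ℕ))
    Fin.val_injective ⟨n, h1⟩
  have e2 := expo_apply (fun j : Fin α.length => (j : ℕ)) (fun j => (α.get j : ℕ))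
    Fin.val_injective ⟨n, h2⟩
  simp only at e1 e2
  rw [partExpo, e1, e2] at this
  exact PNat.coe_injective this

theorem partCoeff_M (α β : List ℕ+) : partCoeff α (M β) = if α = β then 1 else 0 := by
  rw [partCoeff_apply]
  change MvPowerSeries.coeff _ (genFun _ _) = _
  rw [coeff_genFun]
  split_ifs with h
  · subst h
    rw [Nat.cast_eq_one, Nat.card_eq_one_iff_unique]
    refine ⟨⟨fun x y => Subtype.ext ?_⟩, ⟨⟨fun j => (j : ℕ), Fin.val_strictMono, rfl⟩⟩⟩
    rw [(expo_inj x.2.1 x.2.2).1, (expo_inj y.2.1 y.2.2).1]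
  · rw [Nat.cast_eq_zero, Nat.card_eq_zero]
    exact Or.inl ⟨fun x => h (expo_inj x.2.1 x.2.2).2.symm⟩

theorem pairing_h_M (α β : List ℕ+) :
    pairing (hProd α) (M β) = if α = β then 1 else 0 := by
  rw [pairing_h, partCoeff_M]

/-- All monomials of `f` have degree at least `n`. -/
def VanishesBelow (n : ℕ) (f : MvPowerSeries ℕ ℚ) : Prop :=
  ∀ d : ℕ →₀ ℕ, d.degree < n → MvPowerSeries.coeff d f = 0

theorem VanishesBelow.mul_left {n : ℕ} {f : MvPowerSeries ℕ ℚ} (hf : VanishesBelow n f)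
    (g : MvPowerSeries ℕ ℚ) : VanishesBelow n (g * f) := by
  classical
  intro d hd
  rw [MvPowerSeries.coeff_mul]
  refine Finset.sum_eq_zero fun p hp => ?_
  rw [← Finset.HasAntidiagonal.mem_antidiagonal.1 hp, map_add] at hd
  rw [hf p.2 (by omega), mul_zero]

theorem vanishesBelow_genFun {C : Type} [Fintype C] (w : C → ℕ) (P : (C → ℕ) → Prop) :
    VanishesBelow (∑ c, w c) (genFun w P) := by
  intro d hd
  rw [coeff_genFun, Nat.cast_eq_zero, Nat.card_eq_zero]
  refine Or.inl ⟨fun T => hd.ne ?_⟩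
  rw [← T.2.2]
  simp

theorem vanishesBelow_M (α : List ℕ+) : VanishesBelow (size α) (M α : MvPowerSeries ℕ ℚ) := by
  rw [← size_eq]
  exact vanishesBelow_genFun _ _

theorem vanishesBelow_F (α : List ℕ+) : VanishesBelow (size α) (F α : MvPowerSeries ℕ ℚ) := by
  have := vanishesBelow_genFun (fun _ : Fin (size α) => 1) (fun i => Monotone i ∧
      ∀ p q : Fin (size α), (q : ℕ) = p + 1 → i p = i q → (q : ℕ) ∉ compSet α)
  rw [Finset.sum_const, Finset.card_univ, Fintype.card_fin, smul_eq_mul, mul_one] at this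
  exact this

theorem pairing_eq_sum (g : NSym) (f : QSym) :
    pairing g f = (hBasis.repr g).sum fun α c => c * partCoeff α f := by
  rw [pairing, Module.Basis.constr_apply]
  simp [Finsupp.sum, LinearMap.sum_apply]

theorem exists_pairing_eq_zero (g : NSym) : ∃ N : ℕ, ∀ f : QSym,
    VanishesBelow N (f : MvPowerSeries ℕ ℚ) → pairing g f = 0 := by
  refine ⟨(hBasis.repr g).support.sup size + 1, fun f hf => ?_⟩
  rw [pairing_eq_sum]
  refine Finset.sum_eq_zero fun α hα => ?_
  simp only
  rw [partCoeff_apply, hf, mul_zero]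
  rw [degree_partExpo]
  exact Nat.lt_succ_of_le (Finset.le_sup (f := size) hα)

theorem finite_size_lt (N : ℕ) : {α : List ℕ+ | size α < N}.Finite := by
  rw [← Set.finite_coe_iff]
  refine Finite.of_injective (β := Σ n : Fin N, Composition n)
    (fun α => ⟨⟨size α.1, α.2⟩, ⟨α.1.map fun k : ℕ+ => (k : ℕ), by
      intro i hi
      obtain ⟨k, -, rfl⟩ := List.mem_map.1 hi
      exact k.pos, rfl⟩⟩) ?_
  intro α β h
  have h' : α.1.map (fun k : ℕ+ => (k : ℕ)) = β.1.map fun k : ℕ+ => (k : ℕ) := by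
    have := congrArg (fun x : (Σ n : Fin N, Composition n) => x.2.blocks) h
    exact this
  exact Subtype.ext (List.map_injective_iff.2 PNat.coe_injective h')

theorem perp_finite (f : QSym) (g : NSym) :
    (Function.support fun α => pairing g (f * M α) • hProd α).Finite := by
  obtain ⟨N, hN⟩ := exists_pairing_eq_zero g
  refine (finite_size_lt N).subset fun α hα => ?_
  by_contra hlt
  apply hα
  simp only
  rw [hN, zero_smul]
  intro d hd
  exact (vanishesBelow_M α).mul_left f d (lt_of_lt_of_le hd (not_lt.1 hlt))

/-- The operator on `NSym` adjoint to multiplication by `f` on `QSym`, see `pairing_perp`, computed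
in the dual bases `hProd` and `M`. The sum is finite by `perp_finite`. -/
noncomputable def perp (f : QSym) : NSym →ₗ[ℚ] NSym where
  toFun g := ∑ᶠ α : List ℕ+, pairing g (f * M α) • hProd α
  map_add' g g' := by
    rw [← finsum_add_distrib (perp_finite f g) (perp_finite f g')]
    simp [add_smul]
  map_smul' c g := by
    rw [RingHom.id_apply, smul_finsum' _ (perp_finite f g)]
    simp [mul_smul]

theorem perp_apply (f : QSym) (g : NSym) :
    perp f g = ∑ᶠ α : List ℕ+, pairing g (f * M α) • hProd α := rfl

theorem vanishesBelow_of_partCoeff {N : ℕ} {f : QSym}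
    (hf : ∀ α, size α < N → partCoeff α f = 0) :
    VanishesBelow N (f : MvPowerSeries ℕ ℚ) := by
  intro d hd
  let i : Fin d.support.card → ℕ := d.support.orderEmbOfFin rfl
  have hi : StrictMono i := (d.support.orderEmbOfFin rfl).strictMono
  have hpos : ∀ j, 0 < d (i j) := fun j => Nat.pos_of_ne_zero
    (Finsupp.mem_support_iff.1 (Finset.orderEmbOfFin_mem d.support rfl j))
  have hd' : expo i (fun j => d (i j)) = d := by
    ext m
    by_cases hm : m ∈ Set.range i
    · obtain ⟨j, rfl⟩ := hm
      rw [expo_apply i _ hi.injective]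
    · have h1 : m ∉ (((expo i fun j => d (i j)).support : Finset ℕ) : Set ℕ) := by
        rwa [support_expo i _ hi.injective hpos]
      have h2 : m ∉ d.support := by
        intro h
        apply hm
        have := Finset.range_orderEmbOfFin d.support rfl
        rw [← Finset.mem_coe, ← this] at h
        exact h
      rw [Finset.mem_coe, Finsupp.notMem_support_iff] at h1
      rw [h1, Finsupp.notMem_support_iff.1 h2]
  let α : List ℕ+ := List.ofFn fun j => (⟨d (i j), hpos j⟩ : ℕ+)
  have hα : partExpo α = expo (fun j : Fin d.support.card => (j : ℕ)) fun j => d (i j) := by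
    have hl : α.length = d.support.card := List.length_ofFn
    unfold partExpo expo
    refine Fintype.sum_equiv (finCongr hl) _ _ fun j => ?_
    have : α.get j = (⟨d (i (Fin.cast hl j)), hpos _⟩ : ℕ+) :=
      List.get_ofFn (fun j => (⟨d (i j), hpos j⟩ : ℕ+)) j
    simp only [this]
    rfl
  have h1 := f.2.2 _ (fun j => d (i j)) i hi
  rw [hd', ← hα] at h1
  rw [h1]
  refine hf α ?_
  rwa [← degree_partExpo, hα, degree_expo, ← degree_expo i, hd']

theorem pairing_perp (f : QSym) (g : NSym) (b : QSym) :
    pairing (perp f g) b = pairing g (f * b) := by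
  obtain ⟨N, hN⟩ := exists_pairing_eq_zero g
  have hsub : (Function.support fun α => pairing g (f * M α) • hProd α) ⊆
      ((finite_size_lt N).toFinset : Set (List ℕ+)) := by
    intro α hα
    rw [Set.Finite.coe_toFinset]
    by_contra hlt
    apply hα
    simp only
    rw [hN, zero_smul]
    intro d hd
    exact (vanishesBelow_M α).mul_left f d (lt_of_lt_of_le hd (not_lt.1 hlt))
  rw [perp_apply, finsum_eq_sum_of_support_subset _ hsub, map_sum, LinearMap.sum_apply]
  simp only [map_smul, LinearMap.smul_apply, pairing_h, smul_eq_mul]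
  let r : QSym := b - ∑ α ∈ (finite_size_lt N).toFinset, partCoeff α b • M α
  have hr : VanishesBelow N (r : MvPowerSeries ℕ ℚ) := by
    apply vanishesBelow_of_partCoeff
    intro α hα
    simp only [r, map_sub, map_sum, map_smul, partCoeff_M, smul_eq_mul, mul_ite, mul_one, mul_zero,
      Finset.sum_ite_eq]
    rw [if_pos (by simpa using hα), sub_self]
  have hb : b = r + ∑ α ∈ (finite_size_lt N).toFinset, partCoeff α b • M α := by
    simp [r]
  have h0 : pairing g (f * r) = 0 := hN _ (hr.mul_left f)
  conv_rhs => rw [hb, mul_add, map_add, h0, zero_add, Finset.mul_sum, map_sum]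
  refine Finset.sum_congr rfl fun α _ => ?_
  rw [mul_smul_comm, map_smul, smul_eq_mul, mul_comm]

/-- The composition `(i)` with one part, which is the empty composition if `i = 0`. -/
def row (i : ℕ) : List ℕ+ := if hi : 0 < i then [i.toPNat hi] else []

theorem size_row (i : ℕ) : size (row i) = i := by
  unfold row size
  split_ifs with h
  · simp
    rfl
  · simp; omega

theorem creation_finite (m : ℤ) (g : NSym) :
    (Function.support fun i : ℕ => (-1 : ℚ) ^ i • (e (m + i) * perp (F (row i)) g)).Finite := by
  obtain ⟨N, hN⟩ := exists_pairing_eq_zero g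
  refine (Set.finite_lt_nat N).subset fun i hi => ?_
  by_contra hlt
  apply hi
  have : perp (F (row i)) g = 0 := by
    rw [perp_apply]
    apply finsum_eq_zero_of_forall_eq_zero
    intro α
    rw [hN, zero_smul]
    have := vanishesBelow_F (row i)
    rw [size_row] at this
    intro d hd
    rw [mul_comm]
    exact this.mul_left (M α) d (lt_of_lt_of_le hd (not_lt.1 hlt))
  simp [this]

/-- The row-strict noncommutative Bernstein operator `∑ i ≥ 0, (-1) ^ i e_{m + i} F_{(i)}^⊥`. The sum
is finite on each element by `creation_finite`. -/
noncomputable def creation (m : ℤ) : NSym →ₗ[ℚ] NSym where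
  toFun g := ∑ᶠ i : ℕ, (-1 : ℚ) ^ i • (e (m + i) * perp (F (row i)) g)
  map_add' g g' := by
    rw [← finsum_add_distrib (creation_finite m g) (creation_finite m g')]
    simp [mul_add]
  map_smul' c g := by
    rw [RingHom.id_apply, smul_finsum' _ (creation_finite m g)]
    refine finsum_congr fun i => ?_
    rw [map_smul, mul_smul_comm, smul_comm]

/-- The composite of the operators `creation α₁`, `creation α₂`, …, where the last one acts first. -/
noncomputable def creationSeq : List ℤ → NSym →ₗ[ℚ] NSym
  | [] => LinearMap.id
  | m :: α => creation m ∘ₗ creationSeq α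

/-- `R` and `S` are bases of `NSym` and `QSym` that are dual for the pairing. -/
structure IsDualBasis (R : List ℕ+ → NSym) (S : List ℕ+ → QSym) : Prop where
  linInd_left : LinearIndependent ℚ R
  span_left : Submodule.span ℚ (Set.range R) = ⊤
  linInd_right : LinearIndependent ℚ S
  span_right : Submodule.span ℚ (Set.range S) = ⊤
  pairing_eq : ∀ α β, pairing (R α) (S β) = if α = β then 1 else 0

end RowStrictImm

/-!
The proof tests everything against quasisymmetric functions through adjoint operators. The adjoint
`hPerp n` of left multiplication by `h n` extracts the coefficient of `x_0 ^ n` and renames the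
remaining variables (`pairing_h_mul`), so it satisfies a Leibniz rule (`hPerp_mul`). If `0` occurs in
a row-strict tableau of shape `a :: β`, it sits in the corner; removing the corner frees the rest of
the first row from the condition on the column, hence `hPerp (n + 1)` takes `rowStrictDual (a :: β)`
to `esymm (a - 1) * hPerp n (rowStrictDual β)` (`hPerp_rowStrictDual_cons`). Inserting this in the
recursion between the `e`'s and the `h`'s gives a telescoping sum, which shows that left
multiplication by `e n`, `n > 0`, is adjoint to
`rowStrictDual (b :: β) ↦ esymm (b - n) * rowStrictDual β`
(`pairing_e_succ_mul_rowStrictDual_cons`). The adjoint of `creation m` therefore takes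
`rowStrictDual (b :: β)` to `(∑ i, (-1) ^ i * hsymm i * esymm (b - m - i)) * rowStrictDual β`, and the
sum is `1` if `b = m` and `0` otherwise, by the classical relation between complete and elementary
symmetric functions (`sum_hsymm_mul_esymm`). By induction on the number of rows, the functions
`creationSeq α 1` are dual to the `rowStrictDual β` (`pairing_rowStrict_rowStrictDual`).

Duality gives linear independence on both sides. In each degree the functions `rowStrictDual β` are
as many as the `M β`, so they span `QSym`; as the pairing is nondegenerate, a family dual to them is
unique and, by finiteness in each degree, spans `NSym`.
-/

namespace RowStrictImm

/-! ### The adjoint of left multiplication by a complete homogeneous function -/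

/-- The exponent of `x_0 ^ n * x_1 ^ (d 0) * x_2 ^ (d 1) * ⋯`. -/
noncomputable def consExpo (n : ℕ) (d : ℕ →₀ ℕ) : ℕ →₀ ℕ :=
  Finsupp.single 0 n + d.embDomain ⟨Nat.succ, Nat.succ_injective⟩

@[simp] theorem consExpo_zero (n : ℕ) (d : ℕ →₀ ℕ) : consExpo n d 0 = n := by
  rw [consExpo, Finsupp.add_apply, Finsupp.embDomain_of_notMem_range]
  · simp
  · simp

@[simp] theorem consExpo_succ (n : ℕ) (d : ℕ →₀ ℕ) (k : ℕ) : consExpo n d (k + 1) = d k := by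
  have := Finsupp.embDomain_apply_self ⟨Nat.succ, Nat.succ_injective⟩ d k
  simp only [Function.Embedding.coeFn_mk, Nat.succ_eq_add_one] at this
  simp [consExpo, this]

theorem consExpo_injective {n n' : ℕ} {d d' : ℕ →₀ ℕ} (h : consExpo n d = consExpo n' d') :
    n = n' ∧ d = d' := by
  refine ⟨by simpa using DFunLike.congr_fun h 0, Finsupp.ext fun k => ?_⟩
  simpa using DFunLike.congr_fun h (k + 1)

theorem exists_consExpo (p : ℕ →₀ ℕ) : ∃ n d, consExpo n d = p := by
  refine ⟨p 0, p.comapDomain Nat.succ Nat.succ_injective.injOn, Finsupp.ext fun k => ?_⟩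
  cases k <;> simp

theorem consExpo_add (n n' : ℕ) (d d' : ℕ →₀ ℕ) :
    consExpo n d + consExpo n' d' = consExpo (n + n') (d + d') := by
  ext k
  cases k <;> simp

theorem degree_consExpo (n : ℕ) (d : ℕ →₀ ℕ) : (consExpo n d).degree = n + d.degree := by
  rw [consExpo, map_add, Finsupp.degree_single, Finsupp.degree_apply, Finsupp.degree_apply,
    Finsupp.support_embDomain, Finset.sum_map]
  congr 1
  exact Finset.sum_congr rfl fun k _ => Finsupp.embDomain_apply_self ⟨Nat.succ, _⟩ d k

theorem consExpo_expo {k : ℕ} (n : ℕ) (i a : Fin k → ℕ) :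
    consExpo n (expo i a) =
      expo (Fin.cons 0 fun j => i j + 1 : Fin (k + 1) → ℕ) (Fin.cons n a : Fin (k + 1) → ℕ) := by
  rw [expo, expo, Fin.sum_univ_succ, consExpo]
  simp only [Fin.cons_zero, Fin.cons_succ]
  congr 1
  have := map_sum (Finsupp.embDomain.addMonoidHom (M := ℕ) ⟨Nat.succ, Nat.succ_injective⟩)
    (fun j => Finsupp.single (i j) (a j)) Finset.univ
  rw [Finsupp.embDomain.addMonoidHom_apply] at this
  rw [this]
  exact Finset.sum_congr rfl fun j _ => Finsupp.embDomain_single ⟨Nat.succ, _⟩ (i j) (a j)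

theorem consExpo_zero_expo {k : ℕ} (i a : Fin k → ℕ) :
    consExpo 0 (expo i a) = expo (fun j => i j + 1) a := by
  rw [consExpo_expo, expo, expo, Fin.sum_univ_succ]
  simp

theorem consExpo_partExpo (n : ℕ+) (α : List ℕ+) :
    consExpo n (partExpo α) = partExpo (n :: α) := by
  rw [partExpo, consExpo_expo, partExpo]
  congr 1 <;> (funext j; refine Fin.cases ?_ (fun j => ?_) j <;> simp)

/-- The power series in `x_1, x_2, …`, renamed to `x_0, x_1, …`, that is the coefficient of
`x_0 ^ n` in a given power series. -/
noncomputable def coeffHead (n : ℕ) : MvPowerSeries ℕ ℚ →ₗ[ℚ] MvPowerSeries ℕ ℚ where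
  toFun f := fun d => MvPowerSeries.coeff (consExpo n d) f
  map_add' _ _ := rfl
  map_smul' _ _ := rfl

theorem coeff_coeffHead (n : ℕ) (f : MvPowerSeries ℕ ℚ) (d : ℕ →₀ ℕ) :
    MvPowerSeries.coeff d (coeffHead n f) = MvPowerSeries.coeff (consExpo n d) f := rfl

/-- Leibniz rule: compare the coefficients of `x_0 ^ n` in a product of power series in `x_0`. -/
theorem coeffHead_mul (n : ℕ) (f g : MvPowerSeries ℕ ℚ) :
    coeffHead n (f * g) =
      ∑ p ∈ Finset.HasAntidiagonal.antidiagonal n, coeffHead p.1 f * coeffHead p.2 g := by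
  classical
  ext d
  rw [coeff_coeffHead, MvPowerSeries.coeff_mul, map_sum]
  simp only [MvPowerSeries.coeff_mul, coeff_coeffHead]
  rw [← Finset.sum_product']
  symm
  refine Finset.sum_bij (fun q _ => (consExpo q.1.1 q.2.1, consExpo q.1.2 q.2.2)) ?_ ?_ ?_ ?_
  · rintro ⟨p, q⟩ h
    rw [Finset.mem_product, Finset.HasAntidiagonal.mem_antidiagonal, Finset.HasAntidiagonal.mem_antidiagonal] at h
    rw [Finset.HasAntidiagonal.mem_antidiagonal, consExpo_add, h.1, h.2]
  · rintro ⟨⟨p, p'⟩, ⟨q, q'⟩⟩ - ⟨⟨r, r'⟩, ⟨s, s'⟩⟩ - h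
    obtain ⟨h1, h2⟩ := Prod.ext_iff.1 h
    obtain ⟨rfl, rfl⟩ := consExpo_injective h1
    obtain ⟨rfl, rfl⟩ := consExpo_injective h2
    rfl
  · rintro ⟨q, q'⟩ h
    obtain ⟨n1, d1, rfl⟩ := exists_consExpo q
    obtain ⟨n2, d2, rfl⟩ := exists_consExpo q'
    rw [Finset.HasAntidiagonal.mem_antidiagonal, consExpo_add] at h
    obtain ⟨h1, h2⟩ := consExpo_injective h
    exact ⟨((n1, n2), (d1, d2)), by simp [h1, h2], rfl⟩
  · intro _ _
    rfl

theorem coeffHead_mem (n : ℕ) {f : MvPowerSeries ℕ ℚ} (hf : f ∈ QSym) : coeffHead n f ∈ QSym := by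
  obtain ⟨⟨N, hN⟩, hq⟩ := hf
  refine ⟨⟨N, fun d hd => ?_⟩, fun k a i hi => ?_⟩
  · have := hN _ hd
    rw [degree_consExpo] at this
    omega
  · have hc : ∀ i : Fin k → ℕ, StrictMono i →
        StrictMono (Fin.cons 0 fun j => i j + 1 : Fin (k + 1) → ℕ) := by
      intro i hi b c hbc
      induction c using Fin.cases with
      | zero => exact absurd hbc (Fin.not_lt_zero b)
      | succ c =>
        induction b using Fin.cases with
        | zero => simp
        | succ b => simpa using hi (Fin.succ_lt_succ_iff.1 hbc)
    rw [coeff_coeffHead, coeff_coeffHead, consExpo_expo, consExpo_expo, hq _ _ _ (hc i hi),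
      hq _ _ _ (hc _ Fin.val_strictMono)]

/-- The operator on `QSym` adjoint to left multiplication by `h n` on `NSym`, see
`pairing_h_mul`. -/
noncomputable def hPerp (n : ℕ) : QSym →ₗ[ℚ] QSym :=
  ((coeffHead n).comp QSym.val.toLinearMap).codRestrict (Subalgebra.toSubmodule QSym)
    fun f => coeffHead_mem n f.2

theorem coe_hPerp (n : ℕ) (f : QSym) :
    (hPerp n f : MvPowerSeries ℕ ℚ) = coeffHead n (f : MvPowerSeries ℕ ℚ) := rfl

theorem hPerp_mul (n : ℕ) (f g : QSym) :
    hPerp n (f * g) = ∑ p ∈ Finset.HasAntidiagonal.antidiagonal n, hPerp p.1 f * hPerp p.2 g := by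
  apply Subtype.ext
  rw [coe_hPerp, MulMemClass.coe_mul, coeffHead_mul]
  simp [coe_hPerp]

/-- A quasisymmetric function is determined by its coefficients in the monomial basis. -/
theorem ext_partCoeff {f g : QSym} (hfg : ∀ α, partCoeff α f = partCoeff α g) : f = g := by
  rw [← sub_eq_zero]
  apply Subtype.ext
  ext d
  exact vanishesBelow_of_partCoeff (N := d.degree + 1) (f := f - g)
    (fun α _ => by rw [map_sub, hfg, sub_self]) d (Nat.lt_succ_self _)

theorem partCoeff_hPerp (n : ℕ+) (α : List ℕ+) (f : QSym) :
    partCoeff α (hPerp n f) = partCoeff (n :: α) f := by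
  rw [partCoeff_apply, coe_hPerp, coeff_coeffHead, consExpo_partExpo, partCoeff_apply]

theorem partCoeff_hPerp_succ (n : ℕ) (α : List ℕ+) (f : QSym) :
    partCoeff α (hPerp (n + 1) f) = partCoeff (n.succPNat :: α) f :=
  partCoeff_hPerp n.succPNat α f

theorem hPerp_zero (f : QSym) : hPerp 0 f = f := by
  refine ext_partCoeff fun α => ?_
  rw [partCoeff_apply, coe_hPerp, coeff_coeffHead, partExpo, consExpo_zero_expo]
  exact f.2.2 _ _ _ (Fin.val_strictMono.add_const 1)

theorem pairing_h_mul (n : ℕ) (g : NSym) (f : QSym) :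
    pairing (h n * g) f = pairing g (hPerp n f) := by
  have key : (pairing.flip f).comp (LinearMap.mulLeft ℚ (h n)) = pairing.flip (hPerp n f) := by
    refine hBasis.ext fun α => ?_
    simp only [LinearMap.comp_apply, LinearMap.flip_apply, LinearMap.mulLeft_apply, hBasis_apply]
    cases n with
    | zero => rw [h_zero, one_mul, hPerp_zero]
    | succ n =>
      rw [pairing_h, partCoeff_hPerp_succ, ← pairing_h]
      simp [hProd]
  exact LinearMap.congr_fun key g

/-! ### Elementary and complete symmetric functions -/

/-- The elementary symmetric function of degree `k`, which is `0` for `k < 0`. -/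
noncomputable def esymm (k : ℤ) : QSym := if 0 ≤ k then M (List.replicate k.toNat 1) else 0

theorem esymm_of_neg {k : ℤ} (hk : k < 0) : esymm k = 0 := if_neg (not_le.2 hk)

theorem esymm_natCast (k : ℕ) : esymm k = M (List.replicate k 1) := by simp [esymm]

theorem hPerp_esymm (n : ℕ) (k : ℤ) : hPerp n (esymm k) =
    if n = 0 then esymm k else if n = 1 then esymm (k - 1) else 0 := by
  cases n with
  | zero => simp [hPerp_zero]
  | succ n =>
    rw [if_neg n.succ_ne_zero]
    refine ext_partCoeff fun α => ?_
    rw [partCoeff_hPerp_succ]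
    rcases lt_or_ge k 0 with hk | hk
    · rw [esymm_of_neg hk, esymm_of_neg (by omega)]
      simp
    · lift k to ℕ using hk
      rw [esymm_natCast, partCoeff_M]
      cases k with
      | zero => rw [esymm_of_neg (by norm_num)]; simp
      | succ k =>
        have h1 : n.succPNat = 1 ↔ n = 0 := by
          rw [← PNat.coe_inj]; simp
        rw [Nat.cast_succ, add_sub_cancel_right, esymm_natCast]
        simp only [List.replicate_succ, List.cons.injEq, h1]
        by_cases hn : n = 0
        · simp [hn, partCoeff_M]
        · simp [hn]

theorem hPerp_succ_esymm_mul (n : ℕ) (k : ℤ) (f : QSym) :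
    hPerp (n + 1) (esymm k * f) = esymm k * hPerp (n + 1) f + esymm (k - 1) * hPerp n f := by
  rw [hPerp_mul, Finset.Nat.antidiagonal_succ, Finset.sum_cons, Finset.sum_map]
  congr 1
  · simp [hPerp_esymm]
  · cases n with
    | zero => simp [hPerp_esymm]
    | succ n =>
      rw [Finset.Nat.antidiagonal_succ, Finset.sum_cons, Finset.sum_map]
      simp [hPerp_esymm]

/-- The complete homogeneous symmetric function of degree `k`, which is `0` for `k < 0`. -/
noncomputable def hsymm (k : ℤ) : QSym := if 0 ≤ k then F (row k.toNat) else 0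

theorem hsymm_natCast (k : ℕ) : hsymm k = F (row k) := by simp [hsymm]

theorem compSet_row (k : ℕ) : compSet (row k) = ∅ := by
  refine Set.eq_empty_of_forall_notMem fun s ⟨r, h0, h1, _⟩ => ?_
  unfold row at h1
  split_ifs at h1 <;> (simp at h1; try omega)

/-- A word is determined by its content up to order, so exactly one of its rearrangements is weakly
increasing. -/
theorem card_monotone_content {n : ℕ} (d : ℕ →₀ ℕ) (hd : d.degree = n) :
    Nat.card {T : Fin n → ℕ // Monotone T ∧ ∑ c, Finsupp.single (T c) 1 = d} = 1 := by
  have hm : ∀ (n : ℕ) (T : Fin n → ℕ),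
      Finsupp.toMultiset (∑ c, Finsupp.single (T c) 1) = (List.ofFn T : Multiset ℕ) := by
    intro n T
    rw [map_sum, ← Fin.univ_val_map]
    simp only [Finsupp.toMultiset_single, one_smul]
    have h1 := Multiset.sum_map_singleton (Finset.univ.val.map T)
    rwa [Multiset.map_map] at h1
  rw [Nat.card_eq_one_iff_unique]
  refine ⟨⟨fun T T' => Subtype.ext ?_⟩, ?_⟩
  · have h1 : (List.ofFn T.1).Perm (List.ofFn T'.1) := by
      rw [← Multiset.coe_eq_coe, ← hm, ← hm, T.2.2, T'.2.2]
    exact List.ofFn_injective (h1.eq_of_sortedLE T.2.1.sortedLE_ofFn T'.2.1.sortedLE_ofFn)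
  · let l := (Finsupp.toMultiset d).sort (· ≤ ·)
    have hl : l.length = n := by
      rw [Multiset.length_sort, Finsupp.card_toMultiset, ← hd]
      rfl
    refine ⟨⟨fun c => l.get (c.cast hl.symm), ?_, ?_⟩⟩
    · exact (Multiset.pairwise_sort _ _).sortedLE.monotone_get.comp fun _ _ h => h
    · apply Multiset.toFinsupp.symm.injective
      change Finsupp.toMultiset _ = Finsupp.toMultiset _
      rw [hm]
      subst hl
      change ((List.ofFn l.get : List ℕ) : Multiset ℕ) = _
      rw [List.ofFn_get]
      exact Multiset.sort_eq _ _

theorem coeff_hsymm (k : ℤ) (d : ℕ →₀ ℕ) :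
    MvPowerSeries.coeff d (hsymm k : MvPowerSeries ℕ ℚ) = if (d.degree : ℤ) = k then 1 else 0 := by
  rcases lt_or_ge k 0 with hk | hk
  · rw [hsymm, if_neg (not_le.2 hk), if_neg (by omega)]
    simp
  lift k to ℕ using hk
  rw [hsymm_natCast]
  change MvPowerSeries.coeff d (genFun _ _) = _
  rw [coeff_genFun]
  simp only [compSet_row, Set.mem_empty_iff_false, not_false_eq_true, implies_true, and_true]
  split_ifs with h
  · rw [card_monotone_content d (by rw [size_row]; exact_mod_cast h), Nat.cast_one]
  · rw [Nat.cast_eq_zero, Nat.card_eq_zero]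
    refine Or.inl ⟨fun T => h ?_⟩
    rw [← T.2.2]
    simp [size_row]

theorem hPerp_hsymm (n : ℕ) (k : ℤ) : hPerp n (hsymm k) = hsymm (k - n) := by
  apply Subtype.ext
  ext d
  rw [coe_hPerp, coeff_coeffHead, coeff_hsymm, coeff_hsymm, degree_consExpo]
  congr 1
  push_cast
  exact propext ⟨fun h => by omega, fun h => by omega⟩

theorem sum_alternating_telescope {A : Type*} [AddCommGroup A] [Module ℚ A] (v : ℕ → A) (n : ℕ) :
    ∑ k ∈ Finset.range n, (-1 : ℚ) ^ k • (v k + v (k + 1)) = v 0 - (-1 : ℚ) ^ n • v n := by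
  induction n with
  | zero => simp
  | succ n ih =>
    rw [Finset.sum_range_succ, ih, pow_succ, smul_add]
    module

theorem partCoeff_nil_mul (f g : QSym) :
    partCoeff [] (f * g) = partCoeff [] f * partCoeff [] g := by
  have : partExpo [] = 0 := by simp [partExpo, expo]
  simp only [partCoeff_apply, this, MulMemClass.coe_mul, MvPowerSeries.coeff_zero_eq_constantCoeff,
    map_mul]

theorem partCoeff_nil (f : QSym) :
    partCoeff [] f = MvPowerSeries.coeff 0 (f : MvPowerSeries ℕ ℚ) := by
  rw [partCoeff_apply, partExpo, expo]
  simp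

theorem hPerp_succ_hsymm_mul_esymm (n : ℕ) (k l : ℤ) :
    hPerp (n + 1) (hsymm k * esymm l) =
      hsymm (k - (n + 1)) * esymm l + hsymm (k - n) * esymm (l - 1) := by
  rw [mul_comm, hPerp_succ_esymm_mul, hPerp_hsymm, hPerp_hsymm, mul_comm, mul_comm (esymm _)]
  push_cast
  rfl

theorem size_eq_zero {α : List ℕ+} : size α = 0 ↔ α = [] := by
  cases α <;> simp [size]

theorem partCoeff_one (α : List ℕ+) : partCoeff α 1 = if α = [] then 1 else 0 := by
  classical
  rw [partCoeff_apply, OneMemClass.coe_one, MvPowerSeries.coeff_one]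
  congr 1
  rw [← size_eq_zero, ← degree_partExpo, Finsupp.degree_eq_zero_iff]

theorem esymm_zero : esymm 0 = 1 :=
  ext_partCoeff fun α => by
    rw [partCoeff_one, show (0 : ℤ) = (0 : ℕ) from rfl, esymm_natCast, partCoeff_M,
      List.replicate_zero]

theorem hsymm_zero : hsymm 0 = 1 := by
  classical
  apply Subtype.ext
  ext d
  rw [coeff_hsymm, OneMemClass.coe_one, MvPowerSeries.coeff_one]
  congr 1
  rw [Nat.cast_eq_zero, Finsupp.degree_eq_zero_iff]

/-- The generating function identity `H(-t) * E(t) = 1`, in degree `N`. -/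
theorem sum_hsymm_mul_esymm (N : ℕ) :
    ∑ i ∈ Finset.range (N + 1), (-1 : ℚ) ^ i • (hsymm i * esymm (N - i)) =
      if N = 0 then 1 else 0 := by
  rcases Nat.eq_zero_or_pos N with rfl | hN
  · simp [hsymm_zero, esymm_zero]
  rw [if_neg hN.ne']
  -- The constant term vanishes, and each `hPerp (m + 1)` turns the sum into a telescoping one whose
  -- end terms are zero; these are all the monomial coefficients.
  refine ext_partCoeff fun α => ?_
  rw [map_zero]
  rcases α with _ | ⟨n, α⟩
  · rw [map_sum]
    refine Finset.sum_eq_zero fun i hi => ?_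
    rw [map_smul, partCoeff_nil_mul]
    rcases Nat.eq_zero_or_pos i with rfl | hi0
    · rw [← Nat.cast_sub (by omega), esymm_natCast, partCoeff_M, if_neg]
      · simp
      · intro h
        have := congrArg List.length h
        simp at this
        omega
    · rw [partCoeff_nil, coeff_hsymm, if_neg]
      · simp
      · simp; omega
  · rw [← partCoeff_hPerp, ← n.natPred_add_one, map_sum]
    set m := n.natPred
    have hterm : ∀ i ∈ Finset.range (N + 1),
        hPerp (m + 1) ((-1 : ℚ) ^ i • (hsymm i * esymm (N - i))) =
          (-1 : ℚ) ^ i • ((fun j : ℕ => hsymm (j - (m + 1)) * esymm (N - j)) i +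
            (fun j : ℕ => hsymm (j - (m + 1)) * esymm (N - j)) (i + 1)) := by
      intro i _
      rw [map_smul, hPerp_succ_hsymm_mul_esymm]
      simp only [Nat.cast_add, Nat.cast_one, add_sub_add_right_eq_sub, sub_sub]
    rw [Finset.sum_congr rfl hterm, sum_alternating_telescope]
    have h1 : hsymm (((0 : ℕ) : ℤ) - (m + 1)) = 0 := if_neg (by omega)
    have h2 : esymm ((N : ℤ) - ((N + 1 : ℕ) : ℤ)) = 0 := esymm_of_neg (by omega)
    simp only [h1, h2]
    simp

/-! ### The recursion for row-strict dual immaculate functions -/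

section GeneratingFunction

variable {C D : Type} [Fintype C] [Fintype D]

theorem genFun_reindex (φ : C ≃ D) (w : D → ℕ) (P : (D → ℕ) → Prop) :
    genFun w P = genFun (w ∘ φ) fun T => P (T ∘ φ.symm) := by
  ext d
  rw [coeff_genFun, coeff_genFun]
  congr 1
  refine Nat.card_congr ((Equiv.arrowCongr φ (Equiv.refl ℕ)).symm.subtypeEquiv fun T => ?_)
  have h1 : (T ∘ φ) ∘ φ.symm = T := by funext c; simp
  have h2 : ∑ c, Finsupp.single (T (φ c)) (w (φ c)) = ∑ c, Finsupp.single (T c) (w c) :=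
    φ.sum_comp fun c => Finsupp.single (T c) (w c)
  change _ ↔ P ((T ∘ φ) ∘ φ.symm) ∧ ∑ c, Finsupp.single (T (φ c)) (w (φ c)) = d
  rw [h1, h2]

/-- Fillings of a disjoint union with independent conditions are enumerated by the product. -/
theorem genFun_sum {w : C → ℕ} {v : D → ℕ} (hw : ∀ c, 0 < w c) (hv : ∀ c, 0 < v c)
    (P : (C → ℕ) → Prop) (Q : (D → ℕ) → Prop) :
    genFun (Sum.elim w v) (fun T => P (T ∘ Sum.inl) ∧ Q (T ∘ Sum.inr)) =
      genFun w P * genFun v Q := by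
  classical
  ext d
  rw [MvPowerSeries.coeff_mul]
  simp only [coeff_genFun]
  have hf := finite_content hw P
  have hg := finite_content hv Q
  rw [← Finset.sum_coe_sort]
  simp only [← Nat.cast_mul, ← Nat.cast_sum, ← Nat.card_prod]
  rw [← Nat.card_sigma]
  congr 1
  refine Nat.card_congr (Equiv.ofBijective (fun T =>
    ⟨⟨(∑ c, Finsupp.single (T.1 (Sum.inl c)) (w c), ∑ c, Finsupp.single (T.1 (Sum.inr c)) (v c)),
      ?_⟩, ⟨⟨T.1 ∘ Sum.inl, T.2.1.1, rfl⟩, ⟨T.1 ∘ Sum.inr, T.2.1.2, rfl⟩⟩⟩) ⟨?_, ?_⟩)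
  · rw [Finset.HasAntidiagonal.mem_antidiagonal]
    refine Eq.trans ?_ T.2.2
    rw [Fintype.sum_sum_type]
    rfl
  · intro T T' hT
    have h1 := congrArg (fun x : Σ p : Finset.HasAntidiagonal.antidiagonal d,
      {T : C → ℕ // P T ∧ ∑ c, Finsupp.single (T c) (w c) = p.1.1} ×
      {T : D → ℕ // Q T ∧ ∑ c, Finsupp.single (T c) (v c) = p.1.2} =>
        (x.2.1.1, x.2.2.1)) hT
    obtain ⟨h2, h3⟩ := Prod.ext_iff.1 h1
    refine Subtype.ext (funext fun c => ?_)
    rcases c with c | c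
    · exact congrFun h2 c
    · exact congrFun h3 c
  · rintro ⟨⟨⟨d1, d2⟩, hd⟩, ⟨T, hT, hT'⟩, ⟨S, hS, hS'⟩⟩
    dsimp only at hT' hS'
    subst hT' hS'
    refine ⟨⟨Sum.elim T S, ⟨hT, hS⟩, ?_⟩, rfl⟩
    rw [Finset.HasAntidiagonal.mem_antidiagonal] at hd
    rw [Fintype.sum_sum_type]
    exact hd

end GeneratingFunction

theorem coe_esymm_natCast (k : ℕ) :
    (esymm k : MvPowerSeries ℕ ℚ) = genFun (fun _ : Fin k => 1) StrictMono := by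
  have hk : k = (List.replicate k (1 : ℕ+)).length := by simp
  rw [esymm_natCast, genFun_reindex (finCongr hk.symm)]
  change genFun _ _ = _
  congr 1
  · funext j
    simp
  · funext T
    exact propext ⟨fun hT => hT.comp fun _ _ h => h, fun hT b c hbc =>
      @hT (finCongr hk.symm b) (finCongr hk.symm c) hbc⟩

/-- The cells of `a :: β`: the corner, the other cells of the first row, the cells of `β`. -/
def toCell (a : ℕ+) (β : List ℕ+) : Unit ⊕ (Fin a.natPred ⊕ Cell β) → Cell (a :: β)
  | Sum.inl _ => firstCell (a :: β) ⟨0, Nat.succ_pos _⟩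
  | Sum.inr (Sum.inl i) => ⟨⟨0, Nat.succ_pos _⟩, ⟨i + 1, by
      have := a.natPred_add_one
      have := i.2
      simp only [List.get_eq_getElem, List.getElem_cons_zero]
      omega⟩⟩
  | Sum.inr (Sum.inr c) => ⟨c.1.succ, c.2⟩

theorem toCell_bijective (a : ℕ+) (β : List ℕ+) : Function.Bijective (toCell a β) := by
  constructor
  · intro x y hxy
    have h1 := congrArg (fun c => (c.1 : ℕ)) hxy
    have h2 := congrArg (fun c => (c.2 : ℕ)) hxy
    rcases x with _ | i | ⟨r, c⟩ <;> rcases y with _ | j | ⟨s, d⟩ <;>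
      simp only [toCell, firstCell, Fin.val_succ] at h1 h2
    all_goals first | rfl | omega | skip
    · rw [Fin.ext (Nat.succ_injective h2)]
    · obtain rfl : r = s := Fin.ext (Nat.succ_injective h1)
      obtain rfl : c = d := Fin.ext h2
      rfl
  · rintro ⟨r, c⟩
    induction r using Fin.cases with
    | zero =>
      rcases c with ⟨_ | c, hc⟩
      · exact ⟨Sum.inl (), rfl⟩
      · refine ⟨Sum.inr (Sum.inl ⟨c, ?_⟩), rfl⟩
        have := a.natPred_add_one
        simp only [List.get_eq_getElem, Fin.val_zero, List.getElem_cons_zero] at hc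
        omega
    | succ r => exact ⟨Sum.inr (Sum.inr ⟨r, c⟩), rfl⟩

/-- Once the corner is `0`, the column condition between the first row and the others is void. -/
theorem isRowStrictTableau_cons_iff (a : ℕ+) (β : List ℕ+) (T : Cell (a :: β) → ℕ) :
    (IsRowStrictTableau (a :: β) T ∧ T (toCell a β (Sum.inl ())) = 0) ↔
      T (toCell a β (Sum.inl ())) = 0 ∧
      (StrictMono (fun i => T (toCell a β (Sum.inr (Sum.inl i)))) ∧
        ∀ i, 0 < T (toCell a β (Sum.inr (Sum.inl i)))) ∧
      IsRowStrictTableau β fun c => T (toCell a β (Sum.inr (Sum.inr c))) := by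
  constructor
  · rintro ⟨⟨h1, h2⟩, h0⟩
    refine ⟨h0, ⟨fun i j hij => h2 _ _ _ ?_, fun i => ?_⟩, ⟨fun r s hrs => ?_, fun r b c hbc => ?_⟩⟩
    · exact Nat.succ_lt_succ hij
    · rw [← h0]
      exact h2 _ _ _ (Nat.succ_pos _)
    · exact h1 r.succ s.succ (Fin.succ_le_succ_iff.2 hrs)
    · exact h2 r.succ b c hbc
  · rintro ⟨h0, ⟨h1, h1'⟩, ⟨h2, h3⟩⟩
    refine ⟨⟨fun r s hrs => ?_, fun r b c hbc => ?_⟩, h0⟩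
    · induction r using Fin.cases with
      | zero => exact h0.le.trans (Nat.zero_le _)
      | succ r =>
        induction s using Fin.cases with
        | zero => simp at hrs
        | succ s => exact h2 r s (Fin.succ_le_succ_iff.1 hrs)
    · induction r using Fin.cases with
      | zero =>
        have ha := a.natPred_add_one
        obtain ⟨c, hc⟩ := c
        obtain ⟨b, hb⟩ := b
        simp only [List.get_eq_getElem, Fin.val_zero, List.getElem_cons_zero] at hc hb
        obtain _ | c := c
        · exact absurd hbc (Nat.not_lt_zero _)
        · obtain _ | b := b
          · exact h0.trans_lt (h1' ⟨c, by omega⟩)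
          · exact @h1 ⟨b, by omega⟩ ⟨c, by omega⟩ (Nat.lt_of_succ_lt_succ hbc)
      | succ r => exact h3 r b c hbc

theorem genFun_corner_zero (a : ℕ+) (β : List ℕ+) :
    genFun (fun _ : Cell (a :: β) => 1)
        (fun T => IsRowStrictTableau (a :: β) T ∧ T (toCell a β (Sum.inl ())) = 0) =
      genFun (fun _ : Unit => 1) (fun T => T () = 0) *
        (genFun (fun _ : Fin a.natPred => 1) (fun T => StrictMono T ∧ ∀ i, 0 < T i) *
          rowStrictDual β) := by
  change _ = _ * (_ * genFun (fun _ : Cell β => 1) (IsRowStrictTableau β))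
  rw [← genFun_sum (fun _ => one_pos) (fun _ => one_pos),
    ← genFun_sum (fun _ => one_pos) (fun c => by rcases c with c | c <;> exact one_pos),
    genFun_reindex (Equiv.ofBijective _ (toCell_bijective a β))]
  congr 1
  · funext c
    rcases c with c | c | c <;> rfl
  · funext T
    have hs : ∀ x, (T ∘ (Equiv.ofBijective _ (toCell_bijective a β)).symm) (toCell a β x) = T x :=
      fun x => congrArg T ((Equiv.ofBijective _ (toCell_bijective a β)).symm_apply_apply x)
    rw [isRowStrictTableau_cons_iff]
    simp only [hs]
    rfl

theorem coeffHead_genFun_zero (n : ℕ) :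
    coeffHead n (genFun (fun _ : Unit => 1) fun T => T () = 0) = if n = 1 then 1 else 0 := by
  classical
  ext d
  rw [coeff_coeffHead, coeff_genFun]
  have hc : ∀ T : Unit → ℕ, T () = 0 →
      (∑ c, Finsupp.single (T c) 1 = consExpo n d ↔ n = 1 ∧ d = 0) := by
    intro T hT
    rw [Fintype.sum_unique, PUnit.default_eq_unit, hT, eq_comm]
    have h1 : consExpo 1 0 = Finsupp.single 0 1 := by simp [consExpo]
    rw [← h1]
    exact ⟨consExpo_injective, fun h => by rw [h.1, h.2]⟩
  by_cases h : n = 1 ∧ d = 0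
  · rw [Nat.card_eq_one_iff_unique.2, if_pos h.1, h.2]
    · simp
    · refine ⟨⟨fun T T' => Subtype.ext (funext fun u => T.2.1.trans T'.2.1.symm)⟩,
        ⟨⟨fun _ => 0, rfl, (hc _ rfl).2 h⟩⟩⟩
  · rw [Nat.card_eq_zero.2 (Or.inl ⟨fun T => h ((hc _ T.2.1).1 T.2.2)⟩)]
    split_ifs with hn
    · rw [MvPowerSeries.coeff_one, if_neg fun hd => h ⟨hn, hd⟩, Nat.cast_zero]
    · simp

theorem coeffHead_genFun_pos (n k : ℕ) :
    coeffHead n (genFun (fun _ : Fin k => 1) fun T => StrictMono T ∧ ∀ i, 0 < T i) =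
      if n = 0 then (esymm k : MvPowerSeries ℕ ℚ) else 0 := by
  ext d
  rw [coeff_coeffHead, coeff_genFun]
  cases n with
  | zero =>
    rw [if_pos rfl, coe_esymm_natCast, coeff_genFun]
    congr 1
    have hc : ∀ T : Fin k → ℕ, ∑ c, Finsupp.single (T c + 1) 1 =
        consExpo 0 (∑ c, Finsupp.single (T c) 1) := fun T => (consExpo_zero_expo T _).symm
    symm
    refine Nat.card_congr (Equiv.ofBijective
      (fun T => ⟨fun c => T.1 c + 1, ⟨T.2.1.add_const 1, fun _ => Nat.succ_pos _⟩, ?_⟩) ⟨?_, ?_⟩)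
    · rw [hc, T.2.2]
    · intro T T' h
      refine Subtype.ext (funext fun c => ?_)
      exact Nat.succ_injective (congrFun (congrArg Subtype.val h) c)
    · rintro ⟨T, ⟨h1, h2⟩, h3⟩
      have hT : T = fun c => (T c - 1) + 1 := funext fun c => by
        have := h2 c
        omega
      refine ⟨⟨fun c => T c - 1, fun b c hbc => ?_, ?_⟩, Subtype.ext hT.symm⟩
      · have := h1 hbc
        have := h2 b
        simp only
        omega
      · rw [hT, hc] at h3
        exact (consExpo_injective h3).2
  | succ n =>
    rw [if_neg n.succ_ne_zero, Nat.card_eq_zero.2, Nat.cast_zero, map_zero]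
    refine Or.inl ⟨fun T => ?_⟩
    have h := DFunLike.congr_fun T.2.2 0
    rw [consExpo_zero, Finsupp.finsetSum_apply, Finset.sum_eq_zero] at h
    · exact absurd h n.succ_ne_zero.symm
    · exact fun c _ => Finsupp.single_eq_of_ne (T.2.1.2 c).ne

/-- A tableau that contains `0` has it in the corner; apart from the corner, its first row is an
arbitrary strictly increasing sequence of positive entries. -/
theorem hPerp_rowStrictDual_cons (n : ℕ) (a : ℕ+) (β : List ℕ+) :
    hPerp (n + 1) (rowStrictDual (a :: β)) =
      esymm ((a : ℕ) - 1 : ℤ) * hPerp n (rowStrictDual β) := by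
  have h1 : coeffHead (n + 1) (rowStrictDual (a :: β) : MvPowerSeries ℕ ℚ) =
      coeffHead (n + 1) (genFun (fun _ : Cell (a :: β) => 1)
        (fun T => IsRowStrictTableau (a :: β) T ∧ T (toCell a β (Sum.inl ())) = 0)) := by
    ext d
    rw [coeff_coeffHead, coeff_coeffHead, coeff_genFun]
    change MvPowerSeries.coeff _ (genFun _ _) = _
    rw [coeff_genFun]
    congr 1
    refine Nat.card_congr (Equiv.subtypeEquivRight fun T => ?_)
    refine ⟨fun ⟨hT, hd⟩ => ⟨⟨hT, ?_⟩, hd⟩, fun ⟨hT, hd⟩ => ⟨hT.1, hd⟩⟩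
    -- Some cell has entry `0`, and the corner has the smallest entry of the tableau.
    obtain ⟨⟨r, c⟩, hc⟩ : ∃ c, T c = 0 := by
      by_contra! hne
      have h := DFunLike.congr_fun hd 0
      rw [consExpo_zero, Finsupp.finsetSum_apply, Finset.sum_eq_zero] at h
      · exact absurd h n.succ_ne_zero.symm
      · exact fun c _ => Finsupp.single_eq_of_ne (hne c).symm
    have h2 : T (firstCell (a :: β) r) ≤ T ⟨r, c⟩ := by
      rcases Nat.eq_zero_or_pos (c : ℕ) with h0 | h0
      · exact le_of_eq (congrArg (fun c => T ⟨r, c⟩) (Fin.ext h0.symm))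
      · exact (hT.row_lt r _ c h0).le
    have h3 := hT.col_le ⟨0, Nat.succ_pos _⟩ r (Nat.zero_le _)
    exact Nat.le_zero.1 ((h3.trans h2).trans hc.le)
  have ha : ((a : ℕ) - 1 : ℤ) = (a.natPred : ℕ) := by
    have := a.natPred_add_one
    omega
  apply Subtype.ext
  rw [coe_hPerp, h1, genFun_corner_zero, coeffHead_mul,
    Finset.sum_eq_single_of_mem (1, n) (by simp [add_comm])]
  · rw [coeffHead_genFun_zero, if_pos rfl, one_mul, coeffHead_mul,
      Finset.sum_eq_single_of_mem (0, n) (by simp)]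
    · rw [coeffHead_genFun_pos, if_pos rfl, ha]
      rfl
    · rintro ⟨i, j⟩ hp hne
      rw [coeffHead_genFun_pos, if_neg, zero_mul]
      rintro rfl
      simp_all
  · rintro ⟨i, j⟩ hp hne
    rw [coeffHead_genFun_zero, if_neg, zero_mul]
    rintro rfl
    rw [Finset.HasAntidiagonal.mem_antidiagonal] at hp
    apply hne
    ext <;> simp at hp ⊢
    omega

/-! ### The adjoint of left multiplication by an elementary function -/

/-- The recursion of `h_succ`, solved for the elementary generator of top degree. -/
theorem smul_e_succ (n : ℕ) :
    (-1 : ℚ) ^ n • e (n + 1 : ℕ) =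
      h (n + 1) - ∑ k ∈ Finset.range n, (-1 : ℚ) ^ k • (e (k + 1 : ℕ) * h (n - k)) := by
  rw [h_succ, Fin.sum_univ_eq_sum_range
    (fun k => (-1 : ℚ) ^ k • (e (k + 1 : ℕ) * h (n - k))), Finset.sum_range_succ]
  simp [h_zero]

theorem pairing_smul_e_succ_mul (n : ℕ) (g : NSym) (f : QSym) :
    (-1 : ℚ) ^ n * pairing (e (n + 1 : ℕ) * g) f = pairing g (hPerp (n + 1) f) -
      ∑ k ∈ Finset.range n, (-1 : ℚ) ^ k * pairing (e (k + 1 : ℕ) * (h (n - k) * g)) f := by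
  rw [← smul_eq_mul, ← LinearMap.smul_apply, ← map_smul, ← smul_mul_assoc, smul_e_succ, sub_mul,
    map_sub, LinearMap.sub_apply, pairing_h_mul, Finset.sum_mul, map_sum, LinearMap.sum_apply]
  simp only [smul_mul_assoc, map_smul, LinearMap.smul_apply, smul_eq_mul, mul_assoc]

/-- Removing `n + 1` cells from the first row of a row-strict dual immaculate function is adjoint to
left multiplication by `e (n + 1)`; what is left of that row is no longer tied to the column. -/
theorem pairing_e_succ_mul_rowStrictDual_cons (n : ℕ) (g : NSym) (b : ℕ+) (β : List ℕ+) :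
    pairing (e (n + 1 : ℕ) * g) (rowStrictDual (b :: β)) =
      pairing g (esymm ((b : ℕ) - (n + 1 : ℕ) : ℤ) * rowStrictDual β) := by
  induction n using Nat.strong_induction_on generalizing g with
  | _ n ih =>
    -- By the Leibniz rule and the case `k < n`, the `k`-th term of the recursion for `e (n + 1)`
    -- contributes `v k + v (k + 1)`.
    let v : ℕ → ℚ := fun k =>
      pairing g (esymm ((b : ℕ) - (k + 1 : ℕ) : ℤ) * hPerp (n - k) (rowStrictDual β))
    have hterm : ∀ k ∈ Finset.range n, (-1 : ℚ) ^ k *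
        pairing (e (k + 1 : ℕ) * (h (n - k) * g)) (rowStrictDual (b :: β)) =
          (-1 : ℚ) ^ k • (v k + v (k + 1)) := by
      intro k hk
      have hkn := Finset.mem_range.1 hk
      obtain ⟨j, rfl⟩ : ∃ j, n = k + 1 + j := ⟨n - (k + 1), by omega⟩
      rw [ih k hkn, pairing_h_mul]
      simp only [v, smul_eq_mul]
      rw [show k + 1 + j - k = j + 1 by omega, show k + 1 + j - (k + 1) = j by omega,
        hPerp_succ_esymm_mul, map_add,
        show ((b : ℕ) - (k + 1 : ℕ) - 1 : ℤ) = (b : ℕ) - (k + 1 + 1 : ℕ) by push_cast; ring]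
    have h1 := pairing_smul_e_succ_mul n g (rowStrictDual (b :: β))
    rw [Finset.sum_congr rfl hterm, sum_alternating_telescope, hPerp_rowStrictDual_cons] at h1
    have h0 : v 0 = pairing g (esymm ((b : ℕ) - 1 : ℤ) * hPerp n (rowStrictDual β)) := by simp [v]
    have hn : v n = pairing g (esymm ((b : ℕ) - (n + 1 : ℕ) : ℤ) * rowStrictDual β) := by
      simp only [v, Nat.sub_self, hPerp_zero]
    rw [h0, hn, sub_sub_cancel, smul_eq_mul] at h1
    exact mul_left_cancel₀ (pow_ne_zero n (by norm_num)) h1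

theorem size_eq_of_partCoeff_rowStrictDual_ne_zero {α β : List ℕ+}
    (hne : partCoeff α (rowStrictDual β) ≠ 0) : size α = size β := by
  rw [partCoeff_apply] at hne
  change MvPowerSeries.coeff _ (genFun _ _) ≠ 0 at hne
  rw [coeff_genFun, Nat.cast_ne_zero, Nat.card_ne_zero] at hne
  obtain ⟨⟨T, hT, hd⟩⟩ := hne.1
  rw [← degree_partExpo, ← hd, ← size_eq]
  simp

theorem rowStrictDual_nil : rowStrictDual [] = 1 := by
  refine ext_partCoeff fun α => ?_
  rw [partCoeff_one]
  split_ifs with hα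
  · subst hα
    rw [partCoeff_nil]
    change MvPowerSeries.coeff _ (genFun _ _) = _
    have : IsEmpty (Cell []) := ⟨fun c => c.1.elim0⟩
    rw [coeff_genFun, Nat.cast_eq_one, Nat.card_eq_one_iff_unique]
    exact ⟨⟨fun T T' => Subtype.ext (Subsingleton.elim _ _)⟩,
      ⟨⟨fun c => isEmptyElim c, ⟨fun r => r.elim0, fun r => r.elim0⟩, by simp⟩⟩⟩
  · by_contra hne
    exact hα (size_eq_zero.1 (size_eq_of_partCoeff_rowStrictDual_ne_zero hne))

theorem hPerp_succ_one (n : ℕ) : hPerp (n + 1) 1 = 0 := by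
  refine ext_partCoeff fun α => ?_
  rw [partCoeff_hPerp_succ, partCoeff_one, if_neg (List.cons_ne_nil _ _), map_zero]

theorem pairing_e_succ_mul_one (n : ℕ) (g : NSym) : pairing (e (n + 1 : ℕ) * g) 1 = 0 := by
  induction n using Nat.strong_induction_on generalizing g with
  | _ n ih =>
    have h1 := pairing_smul_e_succ_mul n g 1
    rw [Finset.sum_eq_zero fun k hk => by rw [ih k (Finset.mem_range.1 hk), mul_zero],
      hPerp_succ_one, map_zero, sub_zero] at h1
    exact (mul_eq_zero.1 h1).resolve_left (pow_ne_zero n (by norm_num))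

/-! ### Creation operators and duality -/

/-- The defining sum of `creation` may be cut off anywhere above the last nonzero term when tested
against `f`. -/
theorem pairing_creation (m : ℤ) (g : NSym) (f : QSym) {N : ℕ}
    (hN : ∀ i, N < i → pairing (e (m + i) * perp (F (row i)) g) f = 0) :
    pairing (creation m g) f = ∑ i ∈ Finset.range (N + 1),
      (-1 : ℚ) ^ i * pairing (e (m + i) * perp (F (row i)) g) f := by
  change pairing (∑ᶠ i : ℕ, (-1 : ℚ) ^ i • (e (m + i) * perp (F (row i)) g)) f = _
  change pairing.flip f _ = _
  rw [map_finsum _ (creation_finite m g)]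
  simp only [map_smul, LinearMap.flip_apply, smul_eq_mul]
  refine finsum_eq_sum_of_support_subset _ fun i hi => ?_
  simp only [Finset.coe_range, Set.mem_Iio]
  by_contra hlt
  exact hi (by simp only [hN i (by omega), mul_zero])

theorem pairing_creation_rowStrictDual_nil (m : ℕ+) (g : NSym) :
    pairing (creation m g) (rowStrictDual []) = 0 := by
  have h0 : ∀ i : ℕ, pairing (e ((m : ℕ) + i : ℤ) * perp (F (row i)) g) (rowStrictDual []) = 0 := by
    intro i
    rw [rowStrictDual_nil, ← m.natPred_add_one,
      show ((m.natPred + 1 : ℕ) + i : ℤ) = ((m.natPred + i + 1 : ℕ) : ℤ) by push_cast; ring]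
    exact pairing_e_succ_mul_one _ _
  rw [pairing_creation (N := 0) _ _ _ fun i _ => h0 i]
  simp [h0]

/-- `creation m` is adjoint to the operator that removes the first row of a row-strict dual
immaculate function if this row has length `m`, and kills the function otherwise. -/
theorem pairing_creation_rowStrictDual_cons (m : ℕ+) (g : NSym) (b : ℕ+) (β : List ℕ+) :
    pairing (creation m g) (rowStrictDual (b :: β)) =
      if m = b then pairing g (rowStrictDual β) else 0 := by
  have hi : ∀ i : ℕ,
      pairing (e ((m : ℕ) + i : ℤ) * perp (F (row i)) g) (rowStrictDual (b :: β)) =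
        pairing g (hsymm i * esymm ((b : ℕ) - (m : ℕ) - i : ℤ) * rowStrictDual β) := by
    intro i
    have hm := m.natPred_add_one
    rw [show ((m : ℕ) + i : ℤ) = ((m.natPred + i + 1 : ℕ) : ℤ) by push_cast [← hm]; ring,
      pairing_e_succ_mul_rowStrictDual_cons, pairing_perp, hsymm_natCast, mul_assoc]
    congr 4
    push_cast [← hm]
    ring
  -- If `b < m`, the truncated bound is `0`, and the remaining term vanishes too.
  rw [pairing_creation (N := (b : ℕ) - m) _ _ _ fun i hlt => by
    rw [hi, esymm_of_neg (by omega)]; simp]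
  simp only [hi]
  rcases lt_or_ge (b : ℕ) m with hbm | hbm
  · rw [if_neg (by rintro rfl; exact lt_irrefl _ hbm)]
    refine Finset.sum_eq_zero fun i _ => ?_
    rw [esymm_of_neg (by omega)]
    simp
  · have h1 := sum_hsymm_mul_esymm ((b : ℕ) - m)
    rw [Nat.cast_sub hbm] at h1
    have h2 : ∑ i ∈ Finset.range ((b : ℕ) - m + 1), (-1 : ℚ) ^ i *
        pairing g (hsymm i * esymm ((b : ℕ) - (m : ℕ) - i : ℤ) * rowStrictDual β) =
          pairing g ((∑ i ∈ Finset.range ((b : ℕ) - m + 1),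
            (-1 : ℚ) ^ i • (hsymm i * esymm ((b : ℕ) - (m : ℕ) - i : ℤ))) * rowStrictDual β) := by
      rw [Finset.sum_mul, map_sum]
      simp only [smul_mul_assoc, map_smul, smul_eq_mul]
    rw [h2, h1]
    by_cases hmb : m = b
    · subst hmb
      simp
    · have : (b : ℕ) - m ≠ 0 := by
        have : (m : ℕ) ≠ b := fun h => hmb (PNat.coe_injective h)
        omega
      simp [hmb, this]

/-- The row-strict immaculate function, built by creation operators. -/
noncomputable def rowStrict (α : List ℕ+) : NSym := creationSeq (α.map fun k : ℕ+ => (k : ℤ)) 1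

theorem rowStrict_cons (a : ℕ+) (α : List ℕ+) :
    rowStrict (a :: α) = creation a (rowStrict α) := rfl

theorem pairing_rowStrict_rowStrictDual (α β : List ℕ+) :
    pairing (rowStrict α) (rowStrictDual β) = if α = β then 1 else 0 := by
  induction α generalizing β with
  | nil =>
    have h1 : rowStrict [] = hProd [] := rfl
    rw [h1, pairing_h]
    rcases β with _ | ⟨b, β⟩
    · rw [rowStrictDual_nil, partCoeff_one]
    · rw [if_neg (List.cons_ne_nil _ _).symm]
      by_contra hne
      have := size_eq_of_partCoeff_rowStrictDual_ne_zero hne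
      rw [size_eq_zero.2 rfl, eq_comm, size_eq_zero] at this
      exact List.cons_ne_nil _ _ this
  | cons a α ih =>
    rw [rowStrict_cons]
    rcases β with _ | ⟨b, β⟩
    · rw [if_neg (List.cons_ne_nil _ _)]
      exact pairing_creation_rowStrictDual_nil a _
    · rw [pairing_creation_rowStrictDual_cons, ih]
      simp only [List.cons.injEq]
      split_ifs <;> simp_all

/-! ### Bases -/

theorem eq_zero_of_pairing_eq_zero {g : NSym} (hg : ∀ f, pairing g f = 0) : g = 0 := by
  apply hBasis.repr.injective
  ext α
  have h1 := hg (M α)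
  rw [pairing_eq_sum, Finsupp.sum] at h1
  simp only [partCoeff_M, mul_ite, mul_one, mul_zero, Finset.sum_ite_eq'] at h1
  rw [map_zero, Finsupp.zero_apply]
  by_contra hne
  rw [if_pos (Finsupp.mem_support_iff.2 hne)] at h1
  exact hne h1

theorem span_M : Submodule.span ℚ (Set.range M) = ⊤ := by
  refine eq_top_iff.2 fun f _ => ?_
  obtain ⟨N, hN⟩ := f.2.1
  have hf : f = ∑ α ∈ (finite_size_lt (N + 1)).toFinset, partCoeff α f • M α := by
    refine ext_partCoeff fun α => ?_
    simp only [map_sum, map_smul, partCoeff_M, smul_eq_mul, mul_ite, mul_one, mul_zero,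
      Finset.sum_ite_eq]
    split_ifs with hα
    · rfl
    · by_contra hne
      have := hN _ hne
      rw [degree_partExpo] at this
      exact hα (by simpa using Nat.lt_succ_of_le this)
  rw [hf]
  exact Submodule.sum_mem _ fun α _ => Submodule.smul_mem _ _ (Submodule.subset_span ⟨α, rfl⟩)

/-- In each degree, the coefficient matrices of `rowStrict` in the basis `hProd` and of `rowStrictDual`
in the basis `M` are square. By duality one is a one-sided inverse of the transpose of the other,
hence a two-sided one. -/
theorem M_mem_span_rowStrictDual (β : List ℕ+) :
    M β ∈ Submodule.span ℚ (Set.range rowStrictDual) := by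
  classical
  let ι := {α : List ℕ+ // size α = size β}
  have : Finite ι := ((finite_size_lt (size β + 1)).subset fun α (hα : size α = size β) =>
    Nat.lt_succ_of_le hα.le).to_subtype
  have : Fintype ι := Fintype.ofFinite ι
  let P : Matrix ι ι ℚ := fun α γ => partCoeff α.1 (rowStrictDual γ.1)
  let Q : Matrix ι ι ℚ := fun γ α => hBasis.repr (rowStrict γ.1) α.1
  have hQP : Q * P = 1 := by
    ext α γ
    rw [Matrix.mul_apply, Matrix.one_apply]
    have h1 := pairing_rowStrict_rowStrictDual α.1 γ.1
    simp only [← Subtype.ext_iff] at h1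
    rw [← h1, pairing_eq_sum, Finsupp.sum]
    -- The pairing only involves the part of `rowStrict α` of degree `size β`.
    have h2 : ∀ δ ∈ (hBasis.repr (rowStrict α.1)).support, ¬ size δ = size β →
        hBasis.repr (rowStrict α.1) δ * partCoeff δ (rowStrictDual γ.1) = 0 := by
      intro δ _ hδ
      rw [mul_eq_zero]
      refine Or.inr (by_contra fun hne => hδ ?_)
      rw [size_eq_of_partCoeff_rowStrictDual_ne_zero hne, γ.2]
    rw [← Finset.sum_subset (Finset.filter_subset (fun δ => size δ = size β) _)
      fun δ hδ hn => h2 δ hδ fun hs => hn (Finset.mem_filter.2 ⟨hδ, hs⟩)]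
    refine (Finset.sum_map Finset.univ (Function.Embedding.subtype fun α => size α = size β)
      (fun δ => hBasis.repr (rowStrict α.1) δ * partCoeff δ (rowStrictDual γ.1))).symm.trans ?_
    symm
    refine Finset.sum_subset (fun δ hδ => ?_) fun δ hδ hn => ?_
    · have := (Finset.mem_filter.1 hδ).2
      simpa using this
    · have hs : size δ = size β := by simpa using hδ
      have : hBasis.repr (rowStrict α.1) δ = 0 := by
        by_contra hne
        exact hn (Finset.mem_filter.2 ⟨Finsupp.mem_support_iff.2 hne, hs⟩)
      rw [this, zero_mul]
  have hPQ : P * Q = 1 := mul_eq_one_comm.1 hQP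
  have hM : M β = ∑ γ : ι, Q γ ⟨β, rfl⟩ • rowStrictDual γ.1 := by
    refine ext_partCoeff fun α => ?_
    rw [map_sum, partCoeff_M]
    simp only [map_smul, smul_eq_mul]
    by_cases hα : size α = size β
    · have h1 := congrFun (congrFun hPQ ⟨α, hα⟩) ⟨β, rfl⟩
      rw [Matrix.mul_apply, Matrix.one_apply] at h1
      simp only [Subtype.mk.injEq] at h1
      rw [← h1]
      exact Finset.sum_congr rfl fun γ _ => mul_comm _ _
    · rw [if_neg (by rintro rfl; exact hα rfl), Finset.sum_eq_zero]
      intro γ _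
      rw [mul_eq_zero]
      refine Or.inr (by_contra fun hne => hα ?_)
      rw [size_eq_of_partCoeff_rowStrictDual_ne_zero hne, γ.2]
  rw [hM]
  exact Submodule.sum_mem _ fun γ _ => Submodule.smul_mem _ _ (Submodule.subset_span ⟨_, rfl⟩)

theorem span_rowStrictDual : Submodule.span ℚ (Set.range rowStrictDual) = ⊤ := by
  rw [← top_le_iff, ← span_M, Submodule.span_le]
  rintro _ ⟨β, rfl⟩
  exact M_mem_span_rowStrictDual β

theorem eq_of_pairing_rowStrictDual_eq {g g' : NSym}
    (hg : ∀ β, pairing g (rowStrictDual β) = pairing g' (rowStrictDual β)) : g = g' := by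
  rw [← sub_eq_zero]
  refine eq_zero_of_pairing_eq_zero fun f => ?_
  have h1 : pairing g = pairing g' := LinearMap.ext_on_range span_rowStrictDual hg
  rw [map_sub, h1, sub_self, LinearMap.zero_apply]

theorem vanishesBelow_rowStrictDual (α : List ℕ+) :
    VanishesBelow (size α) (rowStrictDual α : MvPowerSeries ℕ ℚ) := by
  have := vanishesBelow_genFun (fun _ : Cell α => 1) (IsRowStrictTableau α)
  have hs : ∑ _c : Cell α, 1 = size α := by
    rw [← size_eq]
    simp
  rw [hs] at this
  exact this

theorem span_rowStrict : Submodule.span ℚ (Set.range rowStrict) = ⊤ := by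
  refine eq_top_iff.2 fun g _ => ?_
  obtain ⟨N, hN⟩ := exists_pairing_eq_zero g
  have hg : g = ∑ α ∈ (finite_size_lt N).toFinset, pairing g (rowStrictDual α) • rowStrict α := by
    refine eq_of_pairing_rowStrictDual_eq fun β => ?_
    simp only [map_sum, LinearMap.sum_apply, map_smul, LinearMap.smul_apply,
      pairing_rowStrict_rowStrictDual, smul_eq_mul, mul_ite, mul_one, mul_zero, Finset.sum_ite_eq']
    split_ifs with hβ
    · rfl
    · have hle : N ≤ size β := by simpa using hβ
      exact hN _ fun d hd => vanishesBelow_rowStrictDual β d (hd.trans_le hle)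
  rw [hg]
  exact Submodule.sum_mem _ fun α _ => Submodule.smul_mem _ _ (Submodule.subset_span ⟨α, rfl⟩)

theorem isDualBasis_rowStrict : IsDualBasis rowStrict rowStrictDual where
  linInd_left := by
    rw [linearIndependent_iff']
    intro s c hc α hα
    have h1 := congrArg (fun g => pairing g (rowStrictDual α)) hc
    simpa [pairing_rowStrict_rowStrictDual, hα] using h1
  span_left := span_rowStrict
  linInd_right := by
    rw [linearIndependent_iff']
    intro s c hc α hα
    have h1 := congrArg (pairing (rowStrict α)) hc
    simpa [pairing_rowStrict_rowStrictDual, hα] using h1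
  span_right := span_rowStrictDual
  pairing_eq := pairing_rowStrict_rowStrictDual

end RowStrictImm

theorem theorem3p14 :
    (∃ R : List ℕ+ → RowStrictImm.NSym,
      RowStrictImm.IsDualBasis R RowStrictImm.rowStrictDual) ∧
    ∀ R : List ℕ+ → RowStrictImm.NSym,
      (∀ α β : List ℕ+, RowStrictImm.pairing (R α) (RowStrictImm.rowStrictDual β) =
        if α = β then 1 else 0) →
      ∀ α : List ℕ+,
        R α = RowStrictImm.creationSeq (α.map fun k : ℕ+ => (k : ℤ)) 1 := by
  refine ⟨⟨_, RowStrictImm.isDualBasis_rowStrict⟩, fun R hR α => ?_⟩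
  refine RowStrictImm.eq_of_pairing_rowStrictDual_eq fun β => ?_
  rw [hR]
  exact (RowStrictImm.pairing_rowStrict_rowStrictDual α β).symm
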